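/- \textbf{Setting.} Let $K\ge 2$. At each time $t\ge1$ a learner observes a context $W_t\in[0,1]^d$, chooses an action $A_t\in[K]$ and receives a reward $Y_t\in\{0,1\}$. Write $O_t=(W_t,A_t,Y_t)$ and let $F_t$ be the $\sigma$-algebra generated by $O_1,\dots,O_t$. The contexts are i.i.d. with law $P_W$ ($W_t$ is independent of $F_{t-1}$), and the conditional mean of $Y_t$ given $F_{t-1},W_t,A_t$ is $q(A_t,W_t)$ for a fixed measurable $q:[K]\times[0,1]^d\to[0,1]$. A policy is a map $\pi:[K]\times[0,1]^d\to\mathbb R_+$ with $\sum_a\pi(a,w)=1$ for all $w$; its value is $\mathcal V(\pi)=E[\sum_a q(a,W)\pi(a,W)]$, $W\sim P_W$. Let $\mathcal F_0$ be a class of measurable real functions on $[0,1]^d$, and let $\mathcal F^{\mathrm{Id}}$ (resp. $\mathcal F^{\mathrm{hinge}}$) be the set of all $f:[K]\times[0,1]^d\to\mathbb R$ with $f(a,\cdot)\in\mathcal F_0$ for all $a$ and with $(f(a,w))_a$ in the probability simplex (resp. with $\sum_a f(a,w)=0$) for all $w$. Put $\phi^{\mathrm{Id}}(x)=x$ and $\phi^{\mathrm{hinge}}(x)=\max(0,1+x)$,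 $\widetilde\pi^{\mathrm{Id}}(f)=f$ and $\widetilde\pi^{\mathrm{hinge}}(f)(a,w)=\mathbf 1\{a=\arg\max_{a'}f(a',w)\}$, where ties are broken by any fixed measurable rule depending on the vector $(f(a',w))_{a'}$. Given $(\phi,\mathcal F,\widetilde\pi)$ and $(\delta_t)_{t\ge1}$, the $\varepsilon$-greedy algorithm starts from $\widehat\pi_0=1/K$ and at each $t\ge1$ draws $A_t$, given $F_{t-1}$ and $W_t$, from $g_t(\cdot,W_t)$ with $g_t=\delta_t/K+(1-\delta_t)\widehat\pi_{t-1}$; then it computes an $F_t$-measurable empirical minimizer $$\widehat f_t\in\arg\min_{f\in\mathcal F}\frac1t\sum_{\tau=1}^t\frac{1/K}{g_\tau(A_\tau,W_\tau)}\,\phi(f(A_\tau,W_\tau))(1-Y_\tau)$$ and sets $\widehat\pi_t=\widetilde\pi(\widehat f_t)$. Let $P^{\mathrm{ref}}$ be the law of $(A,W)$ with $W\sim P_W$ and $A$ uniform on $[K]$ independent of $W$ (the law of $(A_1,W_1)$). The bracketing number $N_{[\,]}(\eta,\mathcal F,L_2(P^{\mathrm{ref}}))$ is the least number of brackets $[l,u]=\{f: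 l\le f\le u\}$, with $l,u$ measurable and $\|u-l\|_{L_2(P^{\mathrm{ref}})}\le\eta$, that cover $\mathcal F$. The hinge-risk of $f$ is $R^{\mathrm{hinge}}(f)=E[\phi^{\mathrm{hinge}}(f(A,W))(1-q(A,W))]$, $(A,W)\sim P^{\mathrm{ref}}$. \textbf{Theorem (high probability regret bound for $\varepsilon$-greedy).} Let $K\ge2$, $p>0$ with $p\neq2$, $c_0>0$ and $B>0$. There is a constant $C>0$, depending only on $K,p,c_0,B$, such that the following holds in the above setting, for all $d$, $P_W$, $q$, $\mathcal F_0$. Let $\delta_t=t^{-(\frac13\wedge\frac1{p+1})}$ for all $t\ge1$, and suppose that either (i) (direct policy optimization) $\phi=\phi^{\mathrm{Id}}$, $\mathcal F=\mathcal F^{\mathrm{Id}}$, $\widetilde\pi=\widetilde\pi^{\mathrm{Id}}$; in this case put $\mathcal V^*=\sup_{\pi\in\mathcal F^{\mathrm{Id}}}\mathcal V(\pi)$; or (ii) (hinge-risk optimization) $\phi=\phi^{\mathrm{hinge}}$, $\mathcal F=\mathcal F^{\mathrm{hinge}}$, $\widetilde\pi=\widetilde\pi^{\mathrm{hinge}}$,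 $|\phi(f_1(a,w))-\phi(f_2(a,w))|\le B$ for all $f_1,f_2\in\mathcal F$ and all $(a,w)$, and hinge-realizability holds: some minimizer of $R^{\mathrm{hinge}}$ over all measurable $f:[K]\times[0,1]^d\to\mathbb R$ with $\sum_af(a,w)=0$ for all $w$ belongs to $\mathcal F^{\mathrm{hinge}}$; in this case put $\mathcal V^*=\sup_\pi\mathcal V(\pi)$ over all measurable policies $\pi$. Suppose also that $\log(1+N_{[\,]}(\eta,\mathcal F,L_2(P^{\mathrm{ref}})))\le c_0\eta^{-p}$ for all $\eta\in(0,1]$. Then for every $t\ge1$ and every $\epsilon\in(0,1)$, with probability at least $1-\epsilon$, $$\sum_{\tau=1}^t(\mathcal V^*-Y_\tau)\le\sqrt{t\log(2/\epsilon)}+C\,t^{\frac23\vee\frac p{p+1}}\sqrt{\log\big(2t(t+1)/\epsilon\big)}.$$ -/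

import Mathlib

open MeasureTheory ProbabilityTheory

noncomputable section

namespace EpsGreedy

/-- The context space `[0,1]^d`. -/
abbrev Ctx (d : ℕ) : Type := Fin d → unitInterval

/-- Real-valued functions of an action and a context (regressors and policies). -/
abbrev Regressor (K d : ℕ) : Type := Fin K × Ctx d → ℝ

/-! ### Bracketing numbers -/

/-- `n` measurable brackets `[l i, u i]` of `L_r(P)`-width at most `η` suffice to cover `F`. -/
def CoveredByBrackets {X : Type*} [MeasurableSpace X] (η : ℝ) (F : Set (X → ℝ))
    (r : ENNReal) (P : Measure X) (n : ℕ) : Prop :=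
  ∃ l u : Fin n → X → ℝ,
    (∀ i, Measurable (l i) ∧ Measurable (u i) ∧
      eLpNorm (u i - l i) r P ≤ ENNReal.ofReal η) ∧
    ∀ f ∈ F, ∃ i, ∀ x, l i x ≤ f x ∧ f x ≤ u i x

/-- The bracketing number `N_[](η, F, L_r(P))`; it is `⊤` if no finite number suffices. -/
def bracketingNumber {X : Type*} [MeasurableSpace X] (η : ℝ) (F : Set (X → ℝ))
    (r : ENNReal) (P : Measure X) : ℕ∞ :=
  ⨅ (n : ℕ) (_ : CoveredByBrackets η F r P n), (n : ℕ∞)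

/-- `log (1 + N_[](η, F, L_2(P))) ≤ c₀ η^{-p}` for every `η ∈ (0,1]`. -/
def EntropyBound {X : Type*} [MeasurableSpace X] (F : Set (X → ℝ)) (P : Measure X)
    (c₀ p : ℝ) : Prop :=
  ∀ η : ℝ, 0 < η → η ≤ 1 →
    bracketingNumber η F 2 P ≠ ⊤ ∧
      Real.log (1 + ((bracketingNumber η F 2 P).toNat : ℝ)) ≤ c₀ * η ^ (-p)

/-! ### Regressors, policies, losses -/

/-- The law of `(A, W)` when `W ∼ PW` and, independently, `A` is uniform over the actions. -/
def refLaw (K : ℕ) {d : ℕ} (PW : Measure (Ctx d)) : Measure (Fin K × Ctx d) :=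
  (uniformOn (Set.univ : Set (Fin K))).prod PW

/-- The class of direct policy optimization: simplex-valued with coordinates in `F₀`. -/
def classId (K : ℕ) {d : ℕ} (F₀ : Set (Ctx d → ℝ)) : Set (Regressor K d) :=
  {f | (∀ a, (fun w => f (a, w)) ∈ F₀) ∧ ∀ w, (fun a => f (a, w)) ∈ stdSimplex ℝ (Fin K)}

/-- The class of hinge-risk optimization: coordinates in `F₀` that sum to zero. -/
def classHinge (K : ℕ) {d : ℕ} (F₀ : Set (Ctx d → ℝ)) : Set (Regressor K d) :=
  {f | (∀ a, (fun w => f (a, w)) ∈ F₀) ∧ ∀ w, ∑ a, f (a, w) = 0}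

/-- The measurable policies. -/
def measurablePolicies (K d : ℕ) : Set (Regressor K d) :=
  {π | Measurable π ∧ ∀ w, (fun a => π (a, w)) ∈ stdSimplex ℝ (Fin K)}

/-- The hinge mapping. -/
def hinge (x : ℝ) : ℝ := max 0 (1 + x)

/-- A measurable choice of a maximizing coordinate (ties are broken by the rule `s`). -/
structure IsArgmaxRule {K : ℕ} (s : (Fin K → ℝ) → Fin K) : Prop where
  measurable : Measurable s
  le_apply : ∀ (v : Fin K → ℝ) (a : Fin K), v a ≤ v (s v)

/-- The policy mapping `f ↦ 1{a = argmax f(·, w)}`, with tie-breaking rule `s`. -/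
def argmaxPolicy {K d : ℕ} (s : (Fin K → ℝ) → Fin K) (f : Regressor K d) : Regressor K d :=
  fun x => if x.1 = s (fun a => f (a, x.2)) then 1 else 0

/-- The loss `φ(f(a,w)) (1 - y)`. -/
def loss {K d : ℕ} (φ : ℝ → ℝ) (f : Regressor K d) (a : Fin K) (w : Ctx d) (y : ℝ) : ℝ :=
  φ (f (a, w)) * (1 - y)

/-- The hinge-risk: the mean of the hinge loss when `W ∼ PW`, `A` is uniform, and `Y` is
Bernoulli with mean `q (A, W)`. It takes the value `∞` if the (nonnegative) loss is not
integrable. -/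
def hingeRisk {K d : ℕ} (PW : Measure (Ctx d)) (q : Fin K × Ctx d → ℝ) (f : Regressor K d) :
    ENNReal :=
  ∫⁻ x, ENNReal.ofReal
    (q x * loss hinge f x.1 x.2 1 + (1 - q x) * loss hinge f x.1 x.2 0) ∂(refLaw K PW)

/-- Hinge-realizability: some minimizer of the hinge-risk over all measurable regressors with
coordinates summing to zero belongs to `F`. -/
def HingeRealizable {K d : ℕ} (PW : Measure (Ctx d)) (q : Fin K × Ctx d → ℝ)
    (F : Set (Regressor K d)) : Prop :=
  ∃ fstar ∈ F, Measurable fstar ∧ (∀ w, ∑ a, fstar (a, w) = 0) ∧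
    ∀ f : Regressor K d, Measurable f → (∀ w, ∑ a, f (a, w) = 0) →
      hingeRisk PW q fstar ≤ hingeRisk PW q f

/-- The value of a policy, where `q (a, w)` is the mean reward of action `a` in context `w`. -/
def value {K d : ℕ} (PW : Measure (Ctx d)) (q : Fin K × Ctx d → ℝ) (π : Regressor K d) : ℝ :=
  ∫ w, ∑ a, q (a, w) * π (a, w) ∂PW

/-! ### The algorithm -/

/-- The σ-algebra generated by the observations `(W_i, A_i, Y_i)`, `1 ≤ i ≤ t`. -/
@[reducible] def history {Ω : Type*} {K d : ℕ} (W : ℕ → Ω → Ctx d) (A : ℕ → Ω → Fin K) (Y : ℕ → Ω → ℝ)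
    (t : ℕ) : MeasurableSpace Ω :=
  ⨆ i ∈ Set.Icc 1 t, MeasurableSpace.comap (W i) inferInstance ⊔
    MeasurableSpace.comap (A i) inferInstance ⊔ MeasurableSpace.comap (Y i) inferInstance

/-- The current policy: uniform at time `0`, and then the policy of the current regressor. -/
def currentPolicy {Ω : Type*} {K d : ℕ} (pmap : Regressor K d → Regressor K d)
    (fhat : ℕ → Ω → Regressor K d) (t : ℕ) (ω : Ω) : Regressor K d :=
  if t = 0 then fun _ => (K : ℝ)⁻¹ else pmap (fhat t ω)

/-- The design `g_t`: the mixture of the uniform policy, with weight `δ t`, and of the policy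
computed at time `t - 1`. -/
def design {Ω : Type*} {K d : ℕ} (pmap : Regressor K d → Regressor K d) (δ : ℕ → ℝ)
    (fhat : ℕ → Ω → Regressor K d) (t : ℕ) (ω : Ω) : Regressor K d :=
  fun x => δ t * (K : ℝ)⁻¹ + (1 - δ t) * currentPolicy pmap fhat (t - 1) ω x

/-- The empirical `φ`-risk of `f` at time `t`, with importance sampling weights. -/
def empiricalRisk {Ω : Type*} {K d : ℕ} (φ : ℝ → ℝ) (g : ℕ → Ω → Regressor K d)
    (W : ℕ → Ω → Ctx d) (A : ℕ → Ω → Fin K) (Y : ℕ → Ω → ℝ) (t : ℕ) (ω : Ω)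
    (f : Regressor K d) : ℝ :=
  (t : ℝ)⁻¹ * ∑ τ ∈ Finset.Icc 1 t,
    (K : ℝ)⁻¹ / g τ ω (A τ ω, W τ ω) * loss φ f (A τ ω) (W τ ω) (Y τ ω)

/-- `(W_t, A_t, Y_t)`, `t ≥ 1`, are the observations of a learner who carries out the
`ε`-greedy algorithm with inputs `φ`, `F`, `pmap`, `δ`, where `fhat t` is the empirical
regressor computed at time `t`, contexts are i.i.d. with law `PW`, and rewards have the fixed
conditional mean `q`. -/
structure IsRun {Ω : Type*} [MeasurableSpace Ω] (μ : Measure Ω) {K d : ℕ}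
    (PW : Measure (Ctx d)) (q : Fin K × Ctx d → ℝ) (φ : ℝ → ℝ) (F : Set (Regressor K d))
    (pmap : Regressor K d → Regressor K d) (δ : ℕ → ℝ) (W : ℕ → Ω → Ctx d)
    (A : ℕ → Ω → Fin K) (Y : ℕ → Ω → ℝ) (fhat : ℕ → Ω → Regressor K d) : Prop where
  measurable_context : ∀ t, Measurable (W t)
  measurable_action : ∀ t, Measurable (A t)
  measurable_reward : ∀ t, Measurable (Y t)
  reward_mem : ∀ t ω, Y t ω = 0 ∨ Y t ω = 1
  /-- Contexts have law `PW`. -/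
  context_law : ∀ t, 1 ≤ t → μ.map (W t) = PW
  /-- The context is independent of the past. -/
  context_indep : ∀ t, 1 ≤ t →
    Indep (history W A Y (t - 1)) (MeasurableSpace.comap (W t) inferInstance) μ
  /-- Given the past and the context, the action is drawn from the design. -/
  action_law : ∀ t, 1 ≤ t → ∀ a : Fin K,
    μ[Set.indicator (A t ⁻¹' {a}) (fun _ => (1 : ℝ)) |
        history W A Y (t - 1) ⊔ MeasurableSpace.comap (W t) inferInstance]
      =ᵐ[μ] fun ω => design pmap δ fhat t ω (a, W t ω)
  /-- Given the past, the context and the action, the reward is Bernoulli with mean `q`. -/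
  reward_law : ∀ t, 1 ≤ t →
    μ[Y t | history W A Y (t - 1) ⊔ MeasurableSpace.comap (W t) inferInstance ⊔
        MeasurableSpace.comap (A t) inferInstance]
      =ᵐ[μ] fun ω => q (A t ω, W t ω)
  /-- The empirical regressor depends measurably on the observations up to time `t`. -/
  fhat_adapted : ∀ t, 1 ≤ t →
    Measurable[(history W A Y t).prod inferInstance]
      (fun x : Ω × (Fin K × Ctx d) => fhat t x.1 x.2)
  fhat_mem : ∀ t, 1 ≤ t → ∀ ω, fhat t ω ∈ F
  /-- The empirical regressor minimizes the empirical risk over `F`. -/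
  fhat_min : ∀ t, 1 ≤ t → ∀ ω, ∀ f ∈ F,
    empiricalRisk φ (design pmap δ fhat) W A Y t ω (fhat t ω) ≤
      empiricalRisk φ (design pmap δ fhat) W A Y t ω f

/-- Direct policy optimization over the class derived from `F₀`. The regret is measured against
the policies in the class. -/
def IsDirectVariant {K d : ℕ} (F₀ : Set (Ctx d → ℝ)) (φ : ℝ → ℝ) (F : Set (Regressor K d))
    (pmap : Regressor K d → Regressor K d) (Comp : Set (Regressor K d)) : Prop :=
  φ = id ∧ F = classId K F₀ ∧ pmap = id ∧ Comp = classId K F₀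

/-- Hinge-risk optimization over the class derived from `F₀`, under hinge-realizability; `B`
bounds the oscillation of the losses over the class. The regret is measured against all
measurable policies. -/
def IsHingeVariant {K d : ℕ} (PW : Measure (Ctx d)) (q : Fin K × Ctx d → ℝ) (B : ℝ)
    (F₀ : Set (Ctx d → ℝ)) (φ : ℝ → ℝ) (F : Set (Regressor K d))
    (pmap : Regressor K d → Regressor K d) (Comp : Set (Regressor K d)) : Prop :=
  φ = hinge ∧ F = classHinge K F₀ ∧ (∃ s, IsArgmaxRule s ∧ pmap = argmaxPolicy s) ∧
    Comp = measurablePolicies K d ∧ HingeRealizable PW q F ∧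
    ∀ f₁ ∈ F, ∀ f₂ ∈ F, ∀ x, |hinge (f₁ x) - hinge (f₂ x)| ≤ B

end EpsGreedy

end

namespace EpsGreedy

/-! ### Exponential inequalities for importance weighted samples -/

/-! Write `δ` for the exploration rate and `x` for the log-confidence level. The regret splits into
the regret of the values of the designs and the sum of value minus reward. The second is a sum of
bounded martingale differences, of order `√(t x)` (`IsRun.exists_sum_value_design_le`). In the
first, exploration costs at most `δ_τ` in round `τ`, so everything rests on showing that the policy
computed at time `t` is suboptimal by only `O(δ_t √x)` (`exists_value_sub_le`). Since `δ` decreases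
by at most a factor 2 per step and `∑ δ_τ` has the order of the asserted power of `t`, a union bound
over the rounds then finishes.

Suboptimality is at most `K` times an excess risk `∫ (φ ∘ f - φ ∘ f*)(1 - q)` under the reference
law, up to a slack `δ_t` (`exists_comparator`). For the identity loss the risk is affine in the
policy; for the hinge loss this is calibration. The weights `K⁻¹ / g_τ` make the empirical excess
risk unbiased and are at most `1 / δ_t`. Empirical minimization makes it nonpositive at the chosen
regressor, so only the lower deviations of weighted sums over the loss class have to be controlled
uniformly.

This one-sidedness is what makes chaining simple (`IsWeightedSample.exists_chain`). Each function is
approximated from below by an increasing chain of lower brackets, starting from the constant `-B`.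
The links are nonnegative, and for nonnegative summands `exp (-y) ≤ 1 - y + y² / 2` gives a
sub-Gaussian lower tail with variance proxy `D ∫ h²`, where `D` bounds the weights. There is no
Bernstein term for the links, so neither truncation nor links of small sup norm are needed. The gap
left after the last link is paid for in mean only, by the width of the last bracket.

With `D = 1 / δ_t` and a last width of about `δ_t`, the chain costs `√(t x / δ_t) · ∑_j 2^{j(p/2-1)}
+ t δ_t`. For `p < 2` the geometric sum is bounded and the cost is `O(t δ_t √x)` because `t δ_t³ ≥
1`. For `p > 2` the sum is of order `δ_t^{-(p/2-1)}`, and the two terms balance because `t δ_t^{p+1}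
= 1`. At `p = 2` the sum would add a logarithm. -/

/-- The product of `1 + y + y² / 2` and `1 - y + y² / 2` is `1 + y⁴ / 4 ≥ 1`. The inequality holds
for every `y ≥ 0` without an upper bound on `y`, which is why the lower tails below need no
restriction on the level. -/
lemma exp_neg_le_quadratic {y : ℝ} (hy : 0 ≤ y) : Real.exp (-y) ≤ 1 - y + y ^ 2 / 2 := by
  have h1 := Real.quadratic_le_exp_of_nonneg hy
  have h2 : 0 < 1 + y + y ^ 2 / 2 := by positivity
  rw [Real.exp_neg]
  calc (Real.exp y)⁻¹ ≤ (1 + y + y ^ 2 / 2)⁻¹ := inv_anti₀ h2 h1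
    _ ≤ 1 - y + y ^ 2 / 2 := by
      rw [inv_le_iff_one_le_mul₀ h2]
      nlinarith [sq_nonneg (y ^ 2)]

lemma integrable_of_measurable_of_abs_le {Ω : Type*} [MeasurableSpace Ω] {μ : Measure Ω}
    [IsFiniteMeasure μ] {f : Ω → ℝ} (hf : Measurable f) {M : ℝ} (hM : ∀ ω, |f ω| ≤ M) :
    Integrable f μ :=
  Integrable.of_bound hf.aestronglyMeasurable M (Filter.Eventually.of_forall hM)

lemma _root_.MeasureTheory.Integrable.mul_of_abs_le {Ω : Type*} [MeasurableSpace Ω]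
    {μ : Measure Ω} {Z f : Ω → ℝ} (hZ : Integrable Z μ) (hf : Measurable f) {M : ℝ}
    (hM : ∀ ω, |f ω| ≤ M) : Integrable (fun ω => Z ω * f ω) μ :=
  hZ.mul_bdd hf.aestronglyMeasurable (Filter.Eventually.of_forall hM)

/-- Chernoff's bound for an adapted bounded process with one-step exponential control. -/
lemma measureReal_sum_ge_le {Ω : Type*} [m : MeasurableSpace Ω] {μ : Measure Ω}
    [IsProbabilityMeasure μ] {ℱ : ℕ → MeasurableSpace Ω} (hle : ∀ n, ℱ n ≤ m)
    (hmono : Monotone ℱ) {X : ℕ → Ω → ℝ} {t : ℕ} {b c l : ℝ}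
    (hX : ∀ τ ∈ Finset.Icc 1 t, Measurable[ℱ τ] (X τ))
    (hb : ∀ τ ∈ Finset.Icc 1 t, ∀ ω, |X τ ω| ≤ b) (hl : 0 ≤ l)
    -- A conditional bound on the moment generating function given the past, stated weakly by
    -- testing against nonnegative bounded past variables `Z`. The induction uses `Z = exp (l *
    -- partial sum)`.
    (hstep : ∀ τ ∈ Finset.Icc 1 t, ∀ Z : Ω → ℝ, Measurable[ℱ (τ - 1)] Z → (∀ ω, 0 ≤ Z ω) →
      (∃ M, ∀ ω, |Z ω| ≤ M) →
        ∫ ω, Z ω * Real.exp (l * X τ ω) ∂μ ≤ Real.exp c * ∫ ω, Z ω ∂μ) (u : ℝ) :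
    μ.real {ω | u ≤ ∑ τ ∈ Finset.Icc 1 t, X τ ω} ≤ Real.exp (-l * u + t * c) := by
  have key : ∀ n, n ≤ t → Measurable[ℱ n] (fun ω => ∑ τ ∈ Finset.Icc 1 n, X τ ω) ∧
      (∀ ω, |∑ τ ∈ Finset.Icc 1 n, X τ ω| ≤ n * b) ∧
      ∫ ω, Real.exp (l * ∑ τ ∈ Finset.Icc 1 n, X τ ω) ∂μ ≤ Real.exp (n * c) := by
    intro n
    induction n with
    | zero => intro _; simp
    | succ n ih =>
      intro hn
      obtain ⟨h1, h2, h3⟩ := ih (by omega)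
      have hmem : n + 1 ∈ Finset.Icc 1 t := by simp; omega
      have hsum : ∀ ω, ∑ τ ∈ Finset.Icc 1 (n + 1), X τ ω =
          ∑ τ ∈ Finset.Icc 1 n, X τ ω + X (n + 1) ω := fun ω =>
        Finset.sum_Icc_succ_top (by omega) _
      simp only [hsum]
      refine ⟨?_, ?_, ?_⟩
      · exact (h1.mono (hmono (Nat.le_succ n)) le_rfl).add (hX _ hmem)
      · intro ω
        refine (abs_add_le _ _).trans ?_
        have := hb _ hmem ω
        have := h2 ω
        push_cast; linarith
      · have := hstep (n + 1) hmem (fun ω => Real.exp (l * ∑ τ ∈ Finset.Icc 1 n, X τ ω))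
          (Real.measurable_exp.comp (h1.const_mul l)) (fun ω => (Real.exp_pos _).le)
          ⟨Real.exp (l * (n * b)), fun ω => by
            rw [abs_of_pos (Real.exp_pos _)]
            exact Real.exp_le_exp.2 (mul_le_mul_of_nonneg_left ((abs_le.1 (h2 ω)).2) hl)⟩
        simp only [mul_add, Real.exp_add] at this ⊢
        refine this.trans ?_
        have h4 : Real.exp (((n + 1 : ℕ) : ℝ) * c) = Real.exp c * Real.exp (n * c) := by
          rw [← Real.exp_add]; congr 1; push_cast; ring
        rw [h4]
        exact mul_le_mul_of_nonneg_left h3 (Real.exp_pos _).le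
  obtain ⟨h1, h2, h3⟩ := key t le_rfl
  have hint : Integrable (fun ω => Real.exp (l * ∑ τ ∈ Finset.Icc 1 t, X τ ω)) μ := by
    refine integrable_of_measurable_of_abs_le (M := Real.exp (l * (t * b)))
      (Real.measurable_exp.comp ((h1.mono (hle t) le_rfl).const_mul l)) fun ω => ?_
    rw [abs_of_pos (Real.exp_pos _)]
    exact Real.exp_le_exp.2 (mul_le_mul_of_nonneg_left ((abs_le.1 (h2 ω)).2) hl)
  refine (measure_ge_le_exp_mul_mgf u hl hint).trans ?_
  rw [Real.exp_add]
  exact mul_le_mul_of_nonneg_left h3 (Real.exp_pos _).le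

/-- An importance weighted sample of size `t`: weights `w τ ∈ [0, D]`, points `O τ` and marks
`L τ ∈ [0, 1]` such that, given the past, `w τ * h (O τ)` has mean `∫ h ∂P` and
`w τ * h (O τ) * L τ` has mean `∫ h * ρ ∂P`. -/
structure IsWeightedSample {Ω X : Type*} [m : MeasurableSpace Ω] [MeasurableSpace X]
    (μ : Measure Ω) (ℱ : ℕ → MeasurableSpace Ω) (P : Measure X) (ρ : X → ℝ) (t : ℕ) (D : ℝ)
    (w L : ℕ → Ω → ℝ) (O : ℕ → Ω → X) : Prop where
  le : ∀ n, ℱ n ≤ m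
  mono : Monotone ℱ
  measurable_weight : ∀ τ ∈ Finset.Icc 1 t, Measurable[ℱ τ] (w τ)
  measurable_mark : ∀ τ ∈ Finset.Icc 1 t, Measurable[ℱ τ] (L τ)
  measurable_point : ∀ τ ∈ Finset.Icc 1 t, Measurable[ℱ τ] (O τ)
  measurable_density : Measurable ρ
  density_mem : ∀ x, 0 ≤ ρ x ∧ ρ x ≤ 1
  weight_mem : ∀ τ ∈ Finset.Icc 1 t, ∀ ω, 0 ≤ w τ ω ∧ w τ ω ≤ D
  mark_mem : ∀ τ ∈ Finset.Icc 1 t, ∀ ω, 0 ≤ L τ ω ∧ L τ ω ≤ 1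
  integral_weight : ∀ τ ∈ Finset.Icc 1 t, ∀ Z : Ω → ℝ, Measurable[ℱ (τ - 1)] Z →
    (∃ M, ∀ ω, |Z ω| ≤ M) → ∀ h : X → ℝ, Measurable h → (∃ M, ∀ x, |h x| ≤ M) →
      ∫ ω, Z ω * (w τ ω * h (O τ ω)) ∂μ = (∫ ω, Z ω ∂μ) * ∫ x, h x ∂P
  integral_weight_mark : ∀ τ ∈ Finset.Icc 1 t, ∀ Z : Ω → ℝ, Measurable[ℱ (τ - 1)] Z →
    (∃ M, ∀ ω, |Z ω| ≤ M) → ∀ h : X → ℝ, Measurable h → (∃ M, ∀ x, |h x| ≤ M) →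
      ∫ ω, Z ω * (w τ ω * h (O τ ω) * L τ ω) ∂μ = (∫ ω, Z ω ∂μ) * ∫ x, h x * ρ x ∂P

/-- The deviation `∑ τ, (∫ h * ρ ∂P - w τ * h (O τ) * L τ)` of the weighted sums. -/
noncomputable def deviation {Ω X : Type*} [MeasurableSpace X] (P : Measure X) (ρ : X → ℝ) (t : ℕ)
    (w L : ℕ → Ω → ℝ) (O : ℕ → Ω → X) (h : X → ℝ) (ω : Ω) : ℝ :=
  ∑ τ ∈ Finset.Icc 1 t, (∫ x, h x * ρ x ∂P - w τ ω * h (O τ ω) * L τ ω)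

namespace IsWeightedSample

set_option linter.unusedSectionVars false

variable {Ω X : Type*} [m : MeasurableSpace Ω] [MeasurableSpace X] {μ : Measure Ω}
  [IsProbabilityMeasure μ] {ℱ : ℕ → MeasurableSpace Ω} {P : Measure X} [IsProbabilityMeasure P]
  {ρ : X → ℝ} {t : ℕ} {D : ℝ} {w L : ℕ → Ω → ℝ} {O : ℕ → Ω → X}

lemma measurable_score (hs : IsWeightedSample μ ℱ P ρ t D w L O) {τ : ℕ}
    (hτ : τ ∈ Finset.Icc 1 t) {h : X → ℝ} (hh : Measurable h) :
    Measurable[ℱ τ] (fun ω => w τ ω * h (O τ ω) * L τ ω) :=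
  ((hs.measurable_weight τ hτ).mul (hh.comp (hs.measurable_point τ hτ))).mul
    (hs.measurable_mark τ hτ)

lemma abs_score_le (hs : IsWeightedSample μ ℱ P ρ t D w L O) {τ : ℕ}
    (hτ : τ ∈ Finset.Icc 1 t) {h : X → ℝ} {M : ℝ} (hM : ∀ x, |h x| ≤ M) (ω : Ω) :
    |w τ ω * h (O τ ω) * L τ ω| ≤ D * M := by
  obtain ⟨h1, h2⟩ := hs.weight_mem τ hτ ω
  obtain ⟨h3, h4⟩ := hs.mark_mem τ hτ ω
  have h5 := hM (O τ ω)
  have h6 := abs_nonneg (h (O τ ω))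
  rw [abs_mul, abs_mul, abs_of_nonneg h1, abs_of_nonneg h3]
  calc w τ ω * |h (O τ ω)| * L τ ω ≤ w τ ω * |h (O τ ω)| * 1 := by gcongr
    _ ≤ D * M := by rw [mul_one]; gcongr; exact h1.trans h2

lemma integrable_mul_density (hs : IsWeightedSample μ ℱ P ρ t D w L O) {h : X → ℝ}
    (hh : Measurable h) {M : ℝ} (hM : ∀ x, |h x| ≤ M) : Integrable (fun x => h x * ρ x) P := by
  refine integrable_of_measurable_of_abs_le (M := M) (hh.mul hs.measurable_density) fun x => ?_
  obtain ⟨h1, h2⟩ := hs.density_mem x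
  rw [abs_mul, abs_of_nonneg h1]
  have := hM x
  have := abs_nonneg (h x)
  nlinarith

lemma abs_integral_mul_density_le (hs : IsWeightedSample μ ℱ P ρ t D w L O) {h : X → ℝ}
    {M : ℝ} (hM : ∀ x, |h x| ≤ M) : |∫ x, h x * ρ x ∂P| ≤ M := by
  refine (norm_integral_le_of_norm_le_const (μ := P) (f := fun x => h x * ρ x) (C := M)
    (Filter.Eventually.of_forall fun x => ?_)).trans (by rw [probReal_univ (μ := P), mul_one])
  obtain ⟨h1, h2⟩ := hs.density_mem x
  rw [Real.norm_eq_abs, abs_mul, abs_of_nonneg h1]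
  have := hM x
  have := abs_nonneg (h x)
  nlinarith

/-- The lower tail of a nonnegative weighted sum is sub-Gaussian. -/
lemma measureReal_deviation_ge_le (hs : IsWeightedSample μ ℱ P ρ t D w L O) (ht : 1 ≤ t)
    (hD : 0 < D) {h : X → ℝ} (hh : Measurable h) (hh0 : ∀ x, 0 ≤ h x) {M : ℝ}
    (hM : ∀ x, |h x| ≤ M) {v : ℝ} (hv : 0 < v) (hv2 : ∫ x, h x ^ 2 ∂P ≤ v ^ 2) {x : ℝ}
    (hx : 0 ≤ x) :
    μ.real {ω | v * Real.sqrt (2 * t * D * x) ≤ deviation P ρ t w L O h ω} ≤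
      Real.exp (-x) := by
  set u := v * Real.sqrt (2 * t * D * x) with hu
  have ht0 : (0 : ℝ) < t := by exact_mod_cast ht
  have hu2 : u ^ 2 = v ^ 2 * (2 * t * D * x) := by
    rw [hu, mul_pow, Real.sq_sqrt (by positivity)]
  -- The minimizer of `-l * u + t * l ^ 2 * D * v ^ 2 / 2`.
  set l := u / (t * D * v ^ 2) with hldef
  have hl : 0 ≤ l := by positivity
  set p := ∫ x, h x * ρ x ∂P with hp
  have := measureReal_sum_ge_le (μ := μ) hs.le hs.mono (t := t) (b := M + D * M)
    (c := l ^ 2 * D * v ^ 2 / 2) (l := l)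
    (X := fun τ ω => p - w τ ω * h (O τ ω) * L τ ω)
    (fun τ hτ => measurable_const.sub (hs.measurable_score hτ hh))
    (fun τ hτ ω => (abs_sub _ _).trans
      (add_le_add (hs.abs_integral_mul_density_le hM) (hs.abs_score_le hτ hM ω))) hl ?_ u
  · refine this.trans (Real.exp_le_exp.2 (le_of_eq ?_))
    have : -l * u + t * (l ^ 2 * D * v ^ 2 / 2) = -(u ^ 2 / (2 * t * D * v ^ 2)) := by
      rw [hldef]; field_simp; ring
    rw [this, hu2]; field_simp
  · intro τ hτ Z hZ hZ0 hZb
    obtain ⟨MZ, hMZ⟩ := hZb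
    have hZm : Measurable Z := hZ.mono (hs.le _) le_rfl
    have hsm := (hs.measurable_score hτ hh).mono (hs.le _) le_rfl
    have hwm : Measurable fun ω => w τ ω * h (O τ ω) ^ 2 := ((hs.measurable_weight τ hτ).mul
      ((hh.pow_const 2).comp (hs.measurable_point τ hτ))).mono (hs.le _) le_rfl
    have hZI : Integrable Z μ := integrable_of_measurable_of_abs_le hZm hMZ
    have hMM : ∀ x, |h x ^ 2| ≤ M ^ 2 := fun x => by
      rw [abs_pow]; exact pow_le_pow_left₀ (abs_nonneg _) (hM x) 2
    have i1 : Integrable (fun ω => Z ω * (w τ ω * h (O τ ω) * L τ ω)) μ :=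
      hZI.mul_of_abs_le hsm (hs.abs_score_le hτ hM)
    have i2 : Integrable (fun ω => Z ω * (w τ ω * h (O τ ω) ^ 2)) μ := by
      refine hZI.mul_of_abs_le (M := D * M ^ 2) hwm fun ω => ?_
      obtain ⟨h1, h2⟩ := hs.weight_mem τ hτ ω
      rw [abs_mul, abs_of_nonneg h1]
      exact mul_le_mul h2 (hMM _) (abs_nonneg _) hD.le
    have i3 : Integrable (fun ω => Z ω - l * (Z ω * (w τ ω * h (O τ ω) * L τ ω))) μ :=
      hZI.sub (i1.const_mul l)
    have e1 := hs.integral_weight_mark τ hτ Z hZ ⟨MZ, hMZ⟩ h hh ⟨M, hM⟩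
    have e2 := hs.integral_weight τ hτ Z hZ ⟨MZ, hMZ⟩ (fun x => h x ^ 2) (hh.pow_const 2)
      ⟨M ^ 2, hMM⟩
    have hbound : ∀ ω, Z ω * Real.exp (l * (p - w τ ω * h (O τ ω) * L τ ω)) ≤
        Real.exp (l * p) * (Z ω - l * (Z ω * (w τ ω * h (O τ ω) * L τ ω)) +
          l ^ 2 * D / 2 * (Z ω * (w τ ω * h (O τ ω) ^ 2))) := by
      intro ω
      obtain ⟨h1, h2⟩ := hs.weight_mem τ hτ ω
      obtain ⟨h3, h4⟩ := hs.mark_mem τ hτ ω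
      have h5 := hh0 (O τ ω)
      set s := w τ ω * h (O τ ω) * L τ ω with hsdef
      have hs0 : 0 ≤ s := by positivity
      -- Only one of the two factors `w` is bounded by `D`; the other one is kept, so that the
      -- conditional mean of the right side is `D * ∫ h ^ 2` and not of order `D ^ 2`.
      have hs2 : s ^ 2 ≤ D * (w τ ω * h (O τ ω) ^ 2) := by
        have : L τ ω ^ 2 ≤ 1 := pow_le_one₀ h3 h4
        calc s ^ 2 = w τ ω * (w τ ω * h (O τ ω) ^ 2) * L τ ω ^ 2 := by rw [hsdef]; ring
          _ ≤ D * (w τ ω * h (O τ ω) ^ 2) * 1 := by gcongr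
          _ = _ := by ring
      have h6 := exp_neg_le_quadratic (mul_nonneg hl hs0)
      have h7 : Real.exp (l * (p - s)) = Real.exp (l * p) * Real.exp (-(l * s)) := by
        rw [← Real.exp_add]; congr 1; ring
      have h8 : Real.exp (-(l * s)) ≤
          1 - l * s + l ^ 2 * D / 2 * (w τ ω * h (O τ ω) ^ 2) := by
        have := mul_le_mul_of_nonneg_left hs2 (sq_nonneg l)
        nlinarith
      rw [h7]
      calc Z ω * (Real.exp (l * p) * Real.exp (-(l * s)))
          = Real.exp (l * p) * (Z ω * Real.exp (-(l * s))) := by ring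
        _ ≤ Real.exp (l * p) * (Z ω * (1 - l * s + l ^ 2 * D / 2 * (w τ ω * h (O τ ω) ^ 2))) :=
          mul_le_mul_of_nonneg_left (mul_le_mul_of_nonneg_left h8 (hZ0 ω)) (Real.exp_pos _).le
        _ = _ := by ring
    have hI0 : 0 ≤ ∫ ω, Z ω ∂μ := integral_nonneg hZ0
    calc ∫ ω, Z ω * Real.exp (l * (p - w τ ω * h (O τ ω) * L τ ω)) ∂μ
        ≤ ∫ ω, Real.exp (l * p) * (Z ω - l * (Z ω * (w τ ω * h (O τ ω) * L τ ω)) +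
          l ^ 2 * D / 2 * (Z ω * (w τ ω * h (O τ ω) ^ 2))) ∂μ :=
          integral_mono_of_nonneg
            (Filter.Eventually.of_forall fun ω => mul_nonneg (hZ0 ω) (Real.exp_pos _).le)
            ((i3.add (i2.const_mul _)).const_mul _)
            (Filter.Eventually.of_forall hbound)
      _ = Real.exp (l * p) * ((∫ ω, Z ω ∂μ) - l * ((∫ ω, Z ω ∂μ) * p) +
          l ^ 2 * D / 2 * ((∫ ω, Z ω ∂μ) * ∫ x, h x ^ 2 ∂P)) := by
          rw [integral_const_mul, integral_add i3 (i2.const_mul _),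
            integral_sub hZI (i1.const_mul l), integral_const_mul, integral_const_mul, e1, e2]
      _ ≤ Real.exp (l * p) * ((∫ ω, Z ω ∂μ) * (-(l * p) + l ^ 2 * D * v ^ 2 / 2 + 1)) := by
          refine mul_le_mul_of_nonneg_left ?_ (Real.exp_pos _).le
          have h9 : l ^ 2 * D / 2 * ((∫ ω, Z ω ∂μ) * ∫ x, h x ^ 2 ∂P) ≤
              l ^ 2 * D / 2 * ((∫ ω, Z ω ∂μ) * v ^ 2) := by gcongr
          nlinarith
      _ ≤ Real.exp (l * p) * ((∫ ω, Z ω ∂μ) * Real.exp (-(l * p) + l ^ 2 * D * v ^ 2 / 2)) := by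
          gcongr
          exact Real.add_one_le_exp _
      _ = _ := by
          rw [Real.exp_add, Real.exp_neg]
          field_simp

/-- The upper tail of the sum of the weighted marks. -/
lemma measureReal_neg_deviation_one_ge_le (hs : IsWeightedSample μ ℱ P ρ t D w L O)
    (ht : 1 ≤ t) (hD : 0 < D) {x : ℝ} (hx : 0 ≤ x) (hxt : x * D ≤ t) :
    μ.real {ω | 2 * Real.sqrt (t * D * x) ≤ -deviation P ρ t w L O (fun _ => 1) ω} ≤
      Real.exp (-x) := by
  have ht0 : (0 : ℝ) < t := by exact_mod_cast ht
  set r := Real.sqrt (t * D * x) with hr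
  have hr2 : r ^ 2 = t * D * x := Real.sq_sqrt (by positivity)
  set l := r / (t * D) with hldef
  have hl : 0 ≤ l := by positivity
  -- For the upper tail the quadratic bound on `exp` needs an exponent of at most 1. This is where
  -- the hypothesis `x * D ≤ t` enters.
  have hlD : l * D ≤ 1 := by
    have h1 : l * D = r / t := by rw [hldef]; field_simp
    rw [h1, div_le_one ht0]
    refine Real.sqrt_le_iff.2 ⟨ht0.le, ?_⟩
    nlinarith
  set p := ∫ x, (1 : ℝ) * ρ x ∂P with hp
  have hone : ∀ x : X, |(1 : ℝ)| ≤ 1 := fun _ => by simp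
  have := measureReal_sum_ge_le (μ := μ) hs.le hs.mono (t := t) (b := 1 + D * 1)
    (c := l ^ 2 * D) (l := l)
    (X := fun τ ω => w τ ω * 1 * L τ ω - p)
    (fun τ hτ => (hs.measurable_score hτ (h := fun _ => 1) measurable_const).sub
      measurable_const)
    (fun τ hτ ω => (abs_sub _ _).trans (by
      rw [add_comm (1 : ℝ)]
      exact add_le_add (hs.abs_score_le hτ hone ω) (hs.abs_integral_mul_density_le hone)))
    hl ?_ (2 * r)
  · have hset : {ω | 2 * r ≤ -deviation P ρ t w L O (fun _ => 1) ω} =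
        {ω | 2 * r ≤ ∑ τ ∈ Finset.Icc 1 t, (w τ ω * 1 * L τ ω - p)} := by
      ext ω
      simp only [deviation, Set.mem_ofPred_eq, ← Finset.sum_neg_distrib, neg_sub, hp]
    rw [hset]
    refine this.trans (Real.exp_le_exp.2 (le_of_eq ?_))
    have : -l * (2 * r) + t * (l ^ 2 * D) = -(r ^ 2 / (t * D)) := by
      rw [hldef]; field_simp; ring
    rw [this, hr2]; field_simp
  · intro τ hτ Z hZ hZ0 hZb
    obtain ⟨MZ, hMZ⟩ := hZb
    have hZm : Measurable Z := hZ.mono (hs.le _) le_rfl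
    have hsm := (hs.measurable_score hτ (h := fun _ => 1) measurable_const).mono
      (hs.le _) le_rfl
    have hwm := (hs.measurable_weight τ hτ).mono (hs.le _) le_rfl
    have hZI : Integrable Z μ := integrable_of_measurable_of_abs_le hZm hMZ
    have i1 : Integrable (fun ω => Z ω * (w τ ω * 1 * L τ ω)) μ :=
      hZI.mul_of_abs_le hsm (hs.abs_score_le hτ hone)
    have i2 : Integrable (fun ω => Z ω * (w τ ω * 1)) μ := by
      refine hZI.mul_of_abs_le (M := D) (hwm.mul_const 1) fun ω => ?_
      obtain ⟨h1, h2⟩ := hs.weight_mem τ hτ ω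
      rw [mul_one, abs_of_nonneg h1]
      exact h2
    have i3 : Integrable (fun ω => Z ω + l * (Z ω * (w τ ω * 1 * L τ ω))) μ :=
      hZI.add (i1.const_mul l)
    have e1 := hs.integral_weight_mark τ hτ Z hZ ⟨MZ, hMZ⟩ (fun _ => 1) measurable_const
      ⟨1, hone⟩
    have e2 := hs.integral_weight τ hτ Z hZ ⟨MZ, hMZ⟩ (fun _ => 1) measurable_const ⟨1, hone⟩
    have hbound : ∀ ω, Z ω * Real.exp (l * (w τ ω * 1 * L τ ω - p)) ≤
        Real.exp (-(l * p)) * (Z ω + l * (Z ω * (w τ ω * 1 * L τ ω)) +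
          l ^ 2 * D * (Z ω * (w τ ω * 1))) := by
      intro ω
      obtain ⟨h1, h2⟩ := hs.weight_mem τ hτ ω
      obtain ⟨h3, h4⟩ := hs.mark_mem τ hτ ω
      set s := w τ ω * 1 * L τ ω with hsdef
      have hs0 : 0 ≤ s := by positivity
      have hsw : s ≤ w τ ω := by rw [hsdef]; nlinarith
      have hs2 : s ^ 2 ≤ D * (w τ ω * 1) := by nlinarith
      have h6 : |Real.exp (l * s) - 1 - l * s| ≤ (l * s) ^ 2 := by
        refine Real.abs_exp_sub_one_sub_id_le ?_
        rw [abs_of_nonneg (mul_nonneg hl hs0)]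
        exact (mul_le_mul_of_nonneg_left (hsw.trans h2) hl).trans hlD
      have h7 : Real.exp (l * (s - p)) = Real.exp (-(l * p)) * Real.exp (l * s) := by
        rw [← Real.exp_add]; congr 1; ring
      have h8 : Real.exp (l * s) ≤ 1 + l * s + l ^ 2 * D * (w τ ω * 1) := by
        have := mul_le_mul_of_nonneg_left hs2 (sq_nonneg l)
        have := (abs_le.1 h6).2
        nlinarith
      rw [h7]
      calc Z ω * (Real.exp (-(l * p)) * Real.exp (l * s))
          = Real.exp (-(l * p)) * (Z ω * Real.exp (l * s)) := by ring
        _ ≤ Real.exp (-(l * p)) * (Z ω * (1 + l * s + l ^ 2 * D * (w τ ω * 1))) :=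
          mul_le_mul_of_nonneg_left (mul_le_mul_of_nonneg_left h8 (hZ0 ω)) (Real.exp_pos _).le
        _ = _ := by ring
    have hI0 : 0 ≤ ∫ ω, Z ω ∂μ := integral_nonneg hZ0
    calc ∫ ω, Z ω * Real.exp (l * (w τ ω * 1 * L τ ω - p)) ∂μ
        ≤ ∫ ω, Real.exp (-(l * p)) * (Z ω + l * (Z ω * (w τ ω * 1 * L τ ω)) +
          l ^ 2 * D * (Z ω * (w τ ω * 1))) ∂μ :=
          integral_mono_of_nonneg
            (Filter.Eventually.of_forall fun ω => mul_nonneg (hZ0 ω) (Real.exp_pos _).le)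
            ((i3.add (i2.const_mul _)).const_mul _)
            (Filter.Eventually.of_forall hbound)
      _ = Real.exp (-(l * p)) * ((∫ ω, Z ω ∂μ) * (l * p + l ^ 2 * D + 1)) := by
          rw [integral_const_mul, integral_add i3 (i2.const_mul _),
            integral_add hZI (i1.const_mul l), integral_const_mul, integral_const_mul, e1, e2]
          simp only [integral_const, probReal_univ, smul_eq_mul, mul_one]
          ring
      _ ≤ Real.exp (-(l * p)) * ((∫ ω, Z ω ∂μ) * Real.exp (l * p + l ^ 2 * D)) := by
          gcongr
          exact Real.add_one_le_exp _
      _ = _ := by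
          rw [Real.exp_add, Real.exp_neg]
          field_simp

end IsWeightedSample


/-! ### Chaining with brackets from below -/

/-- The value `y` clamped to `[a, b]`. -/
noncomputable def clamp (a b y : ℝ) : ℝ := max a (min b y)

lemma le_clamp (a b y : ℝ) : a ≤ clamp a b y := le_max_left _ _

lemma clamp_le {a b : ℝ} (h : a ≤ b) (y : ℝ) : clamp a b y ≤ b := max_le h (min_le_left _ _)

lemma clamp_mono (a b : ℝ) {y z : ℝ} (h : y ≤ z) : clamp a b y ≤ clamp a b z :=
  max_le_max le_rfl (min_le_min le_rfl h)

lemma clamp_eq {a b y : ℝ} (h₁ : a ≤ y) (h₂ : y ≤ b) : clamp a b y = y := by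
  rw [clamp, min_eq_right h₂, max_eq_right h₁]

lemma abs_clamp_sub_le (a b y z : ℝ) : |clamp a b y - clamp a b z| ≤ |y - z| := by
  unfold clamp
  refine (abs_max_sub_max_le_max _ _ _ _).trans ?_
  refine max_le (by simp) ?_
  refine (abs_min_sub_min_le_max _ _ _ _).trans ?_
  exact max_le (by simp) le_rfl

/-- Integrate `2 v f ≤ f² + v²`; this replaces Cauchy–Schwarz for a probability measure. -/
lemma integral_le_of_integral_sq_le {X : Type*} [MeasurableSpace X] {P : Measure X}
    [IsProbabilityMeasure P] {f : X → ℝ} {v : ℝ} (hv : 0 < v) (hf : Integrable f P)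
    (hf2 : Integrable (fun x => f x ^ 2) P) (h : ∫ x, f x ^ 2 ∂P ≤ v ^ 2) :
    ∫ x, f x ∂P ≤ v := by
  have h1 : ∫ x, (2 * v) * f x ∂P ≤ ∫ x, (f x ^ 2 + v ^ 2) ∂P :=
    integral_mono (hf.const_mul _) (hf2.add (integrable_const _)) fun x => by
      have := sq_nonneg (f x - v)
      simp only
      nlinarith
  rw [integral_const_mul, integral_add hf2 (integrable_const _)] at h1
  simp only [integral_const, probReal_univ, smul_eq_mul, one_mul] at h1
  nlinarith

/-- The width of the brackets after `j` steps of chaining. -/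
noncomputable def chainWidth (B : ℝ) : ℕ → ℝ
  | 0 => 2 * B
  | j + 1 => (1 / 2) ^ j

lemma chainWidth_pos {B : ℝ} (hB : 0 < B) (j : ℕ) : 0 < chainWidth B j := by
  cases j <;> simp [chainWidth, hB]

/-- The bound that `J` steps of chaining give for the deviations. -/
noncomputable def chainBound (B D x : ℝ) (t : ℕ) (G : ℕ → ℝ) (J : ℕ) : ℝ :=
  B * (2 * Real.sqrt (t * D * x)) + ∑ j ∈ Finset.range J,
    chainWidth B j * Real.sqrt (2 * t * D * (x + G (j + 1) + (j + 1 : ℕ) * Real.log 2))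

/-- Brackets `[l j i, u j i]`, `i < N j`, of `L₂(P)`-width at most `2⁻ʲ` cover `Ψ`. -/
structure IsBracketing {X : Type*} [MeasurableSpace X] (P : Measure X) (Ψ : Set (X → ℝ))
    (N : ℕ → ℕ) (l u : ∀ j, Fin (N j) → X → ℝ) : Prop where
  measurable_left : ∀ j i, Measurable (l j i)
  measurable_right : ∀ j i, Measurable (u j i)
  integrable_sq : ∀ j i, Integrable (fun x => (u j i x - l j i x) ^ 2) P
  integral_sq_le : ∀ j i, ∫ x, (u j i x - l j i x) ^ 2 ∂P ≤ ((1 / 2) ^ j) ^ 2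
  cover : ∀ j, ∀ f ∈ Ψ, ∃ i, ∀ x, l j i x ≤ f x ∧ f x ≤ u j i x

namespace IsWeightedSample

set_option linter.unusedSectionVars false

variable {Ω X : Type*} [m : MeasurableSpace Ω] [MeasurableSpace X] {μ : Measure Ω}
  [IsProbabilityMeasure μ] {ℱ : ℕ → MeasurableSpace Ω} {P : Measure X} [IsProbabilityMeasure P]
  {ρ : X → ℝ} {t : ℕ} {D : ℝ} {w L : ℕ → Ω → ℝ} {O : ℕ → Ω → X}

lemma deviation_add_sub (hs : IsWeightedSample μ ℱ P ρ t D w L O) {f g : X → ℝ}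
    (hf : Measurable f) (hg : Measurable g) {M : ℝ} (hfM : ∀ x, |f x| ≤ M)
    (hgM : ∀ x, |g x| ≤ M) (ω : Ω) :
    deviation P ρ t w L O g ω =
      deviation P ρ t w L O f ω + deviation P ρ t w L O (fun x => g x - f x) ω := by
  have h : ∫ x, (g x - f x) * ρ x ∂P = ∫ x, g x * ρ x ∂P - ∫ x, f x * ρ x ∂P := by
    rw [← integral_sub (hs.integrable_mul_density hg hgM) (hs.integrable_mul_density hf hfM)]
    simp only [sub_mul]
  simp only [deviation, h]
  rw [← Finset.sum_add_distrib]
  exact Finset.sum_congr rfl fun τ _ => by ring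

/-- Each step intersects the current brackets with those of the next scale by clamping. The lower
ends therefore only move up, by at most the previous width, and the sub-Gaussian lower tail applies
to each increment. The index type `ι` of the surviving brackets grows by the factor `N J`, which `G`
records for the union bound. -/
theorem exists_chain (hs : IsWeightedSample μ ℱ P ρ t D w L O) (ht : 1 ≤ t) (hD : 0 < D)
    {B : ℝ} (hB : 0 < B) {x : ℝ} (hx : 0 ≤ x) (hxt : x * D ≤ t) {Ψ : Set (X → ℝ)}
    (hΨ : ∀ f ∈ Ψ, ∀ y, |f y| ≤ B) {N : ℕ → ℕ} {l u : ∀ j, Fin (N j) → X → ℝ}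
    (hbr : IsBracketing P Ψ N l u) {G : ℕ → ℝ} (hG0 : ∀ j, 0 ≤ G j)
    (hG : ∀ j, Real.exp (G j) * N j ≤ Real.exp (G (j + 1))) (J : ℕ) :
    ∃ E : Set Ω, μ.real E ≤ (2 - (1 / 2) ^ J) * Real.exp (-x) ∧
      ∃ (ι : Type) (_ : Fintype ι) (a b : ι → X → ℝ),
        (Fintype.card ι : ℝ) ≤ Real.exp (G J) ∧
        (∀ i, Measurable (a i) ∧ Measurable (b i) ∧
          (∀ y, -B ≤ a i y ∧ a i y ≤ b i y ∧ b i y ≤ B) ∧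
          ∫ y, (b i y - a i y) ^ 2 ∂P ≤ chainWidth B J ^ 2) ∧
        (∀ f ∈ Ψ, ∃ i, ∀ y, a i y ≤ f y ∧ f y ≤ b i y) ∧
        ∀ ω, ω ∉ E → ∀ i, deviation P ρ t w L O (a i) ω ≤ chainBound B D x t G J := by
  induction J with
  | zero =>
    -- The chain starts from the single bracket `[-B, B]`. The deviation of the constant `-B` is `B`
    -- times the upper deviation of the weighted marks, the only place where an upper tail is used.
    refine ⟨{ω | 2 * Real.sqrt (t * D * x) ≤ -deviation P ρ t w L O (fun _ => 1) ω}, ?_,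
      Unit, inferInstance, fun _ _ => -B, fun _ _ => B, ?_, ?_, ?_, ?_⟩
    · refine (hs.measureReal_neg_deviation_one_ge_le ht hD hx hxt).trans (le_of_eq ?_)
      norm_num
    · simpa using hG0 0
    · refine fun _ => ⟨measurable_const, measurable_const, fun y => ⟨le_rfl, ?_, le_rfl⟩, ?_⟩
      · linarith
      · simp only [integral_const, probReal_univ, smul_eq_mul, chainWidth]
        exact le_of_eq (by ring)
    · exact fun f hf => ⟨(), fun y => abs_le.1 (hΨ f hf y)⟩
    · intro ω hω _
      have h1 : -deviation P ρ t w L O (fun _ => 1) ω < 2 * Real.sqrt (t * D * x) :=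
        not_le.1 hω
      have h2 : deviation P ρ t w L O (fun _ => -B) ω =
          B * -deviation P ρ t w L O (fun _ => 1) ω := by
        simp only [deviation, integral_const_mul, ← Finset.sum_neg_distrib, Finset.mul_sum]
        exact Finset.sum_congr rfl fun τ _ => by ring
      rw [h2, chainBound, Finset.range_zero, Finset.sum_empty, add_zero]
      exact mul_le_mul_of_nonneg_left h1.le hB.le
  | succ J ih =>
    obtain ⟨E, hE, ι, _, a, b, hcard, hab, hcov, hdev⟩ := ih
    set a' : ι × Fin (N J) → X → ℝ := fun i y => clamp (a i.1 y) (b i.1 y) (l J i.2 y) with ha'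
    -- The maximum with `a'` is needed because a bracket is not assumed to satisfy `l ≤ u`
    -- pointwise, and pairs of brackets without a common function are kept.
    set b' : ι × Fin (N J) → X → ℝ := fun i y =>
      max (a' i y) (clamp (a i.1 y) (b i.1 y) (u J i.2 y)) with hb'
    -- The term `G (J + 1)` pays for the union over the links of this step and `(J + 1) * log 2`
    -- makes the failure probabilities summable over the steps, with total below `2 * exp (-x)`.
    set x' := x + G (J + 1) + (J + 1 : ℕ) * Real.log 2 with hx'
    have hx'0 : 0 ≤ x' := by have := hG0 (J + 1); positivity
    have ham : ∀ i, Measurable (a' i) := fun i =>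
      (hab i.1).1.max ((hab i.1).2.1.min (hbr.measurable_left J i.2))
    have hbm : ∀ i, Measurable (b' i) := fun i => (ham i).max
      ((hab i.1).1.max ((hab i.1).2.1.min (hbr.measurable_right J i.2)))
    have hle : ∀ i y, a i.1 y ≤ a' i y ∧ a' i y ≤ b' i y ∧ b' i y ≤ b i.1 y := fun i y => by
      obtain ⟨-, -, h, -⟩ := hab i.1
      exact ⟨le_clamp _ _ _, le_max_left _ _,
        max_le (clamp_le (h y).2.1 _) (clamp_le (h y).2.1 _)⟩
    have hB1 : ∀ i y, |a i y| ≤ B := fun i y => by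
      obtain ⟨-, -, h, -⟩ := hab i
      exact abs_le.2 ⟨(h y).1, (h y).2.1.trans (h y).2.2⟩
    have hB2 : ∀ i y, |a' i y| ≤ B := fun i y => by
      obtain ⟨-, -, h, -⟩ := hab i.1
      exact abs_le.2 ⟨(h y).1.trans (hle i y).1,
        ((hle i y).2.1.trans (hle i y).2.2).trans (h y).2.2⟩
    set Bad : ι × Fin (N J) → Set Ω := fun i =>
      {ω | chainWidth B J * Real.sqrt (2 * t * D * x') ≤
        deviation P ρ t w L O (fun y => a' i y - a i.1 y) ω} with hBad
    have hBadm : ∀ i, μ.real (Bad i) ≤ Real.exp (-x') := by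
      intro i
      obtain ⟨h1, h2, h3, h4⟩ := hab i.1
      have h21 : Measurable fun y => b i.1 y - a i.1 y := h2.sub h1
      refine hs.measureReal_deviation_ge_le ht hD (h := fun y => a' i y - a i.1 y)
        ((ham i).sub h1)
        (fun y => sub_nonneg.2 (hle i y).1) (M := B + B)
        (fun y => (abs_sub _ _).trans (add_le_add (hB2 i y) (hB1 i.1 y)))
        (chainWidth_pos hB J) (le_trans ?_ h4) hx'0
      -- The link `a' - a` lies between 0 and the width of the parent bracket, so its second moment
      -- is at most `chainWidth B J ^ 2`.
      refine integral_mono_of_nonneg (Filter.Eventually.of_forall fun y => sq_nonneg _)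
        (integrable_of_measurable_of_abs_le (M := (2 * B) ^ 2) (h21.pow_const 2)
          fun y => ?_)
        (Filter.Eventually.of_forall fun y => ?_)
      · rw [abs_of_nonneg (sq_nonneg _)]
        have := h3 y
        exact pow_le_pow_left₀ (by linarith) (by linarith) 2
      · have := hle i y
        exact pow_le_pow_left₀ (by linarith) (by linarith) 2
    refine ⟨E ∪ ⋃ i, Bad i, ?_, ι × Fin (N J), inferInstance, a', b', ?_, ?_, ?_, ?_⟩
    · refine (measureReal_union_le _ _).trans ?_
      have h1 : μ.real (⋃ i, Bad i) ≤ (1 / 2) ^ (J + 1) * Real.exp (-x) := by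
        calc μ.real (⋃ i, Bad i) ≤ ∑ i, μ.real (Bad i) := measureReal_iUnion_fintype_le _
          _ ≤ ∑ _i : ι × Fin (N J), Real.exp (-x') := Finset.sum_le_sum fun i _ => hBadm i
          _ = (Fintype.card ι * N J) * Real.exp (-x') := by simp
          _ ≤ (Real.exp (G J) * N J) * Real.exp (-x') := by gcongr
          _ ≤ Real.exp (G (J + 1)) * Real.exp (-x') := by gcongr; exact hG J
          _ = _ := by
            have : (1 / 2 : ℝ) ^ (J + 1) = Real.exp (-((J + 1 : ℕ) * Real.log 2)) := by
              rw [Real.exp_neg, Real.exp_nat_mul, Real.exp_log two_pos, one_div, inv_pow]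
            rw [this, ← Real.exp_add, ← Real.exp_add, hx']
            congr 1; ring
      calc μ.real E + μ.real (⋃ i, Bad i)
          ≤ (2 - (1 / 2) ^ J) * Real.exp (-x) + (1 / 2) ^ (J + 1) * Real.exp (-x) :=
            add_le_add hE h1
        _ = _ := by ring
    · rw [Fintype.card_prod, Fintype.card_fin, Nat.cast_mul]
      exact (mul_le_mul_of_nonneg_right hcard (Nat.cast_nonneg _)).trans (hG J)
    · intro i
      refine ⟨ham i, hbm i, fun y => ?_, ?_⟩
      · obtain ⟨-, -, h, -⟩ := hab i.1
        exact ⟨(h y).1.trans (hle i y).1, (hle i y).2.1, (hle i y).2.2.trans (h y).2.2⟩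
      · refine le_trans ?_ (hbr.integral_sq_le J i.2)
        refine integral_mono_of_nonneg (Filter.Eventually.of_forall fun y => sq_nonneg _)
          (hbr.integrable_sq J i.2) (Filter.Eventually.of_forall fun y => ?_)
        refine sq_le_sq' ?_ ?_ |>.trans_eq (sq_abs (u J i.2 y - l J i.2 y))
        · have := (hle i y).2.1
          have := abs_nonneg (u J i.2 y - l J i.2 y)
          linarith
        · have h1 := abs_clamp_sub_le (a i.1 y) (b i.1 y) (u J i.2 y) (l J i.2 y)
          have h2 := le_abs_self
            (clamp (a i.1 y) (b i.1 y) (u J i.2 y) - clamp (a i.1 y) (b i.1 y) (l J i.2 y))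
          have h3 := abs_nonneg (u J i.2 y - l J i.2 y)
          rw [sub_le_iff_le_add]
          refine max_le ?_ ?_
          · linarith
          · simp only [ha']; linarith
    · intro f hf
      obtain ⟨i, hi⟩ := hcov f hf
      obtain ⟨k, hk⟩ := hbr.cover J f hf
      refine ⟨(i, k), fun y => ?_⟩
      have h := clamp_eq (hi y).1 (hi y).2
      constructor
      · rw [← h]; exact clamp_mono _ _ (hk y).1
      · rw [← h]; exact le_max_of_le_right (clamp_mono _ _ (hk y).2)
    · intro ω hω i
      simp only [Set.mem_union, Set.mem_iUnion, not_or, not_exists] at hω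
      have h1 := hdev ω hω.1 i.1
      have h2 : deviation P ρ t w L O (fun y => a' i y - a i.1 y) ω <
        chainWidth B J * Real.sqrt (2 * t * D * x') := not_le.1 (hω.2 i)
      rw [hs.deviation_add_sub (hab i.1).1 (ham i) (hB1 i.1) (hB2 i) ω, chainBound,
        Finset.sum_range_succ, ← add_assoc]
      exact add_le_add h1 h2.le

/-- With high probability, every function of a class with small brackets that has a nonpositive
weighted sum has a small mean. -/
theorem exists_integral_le (hs : IsWeightedSample μ ℱ P ρ t D w L O) (ht : 1 ≤ t) (hD : 0 < D)
    {B : ℝ} (hB : 0 < B) {x : ℝ} (hx : 0 ≤ x) (hxt : x * D ≤ t) {Ψ : Set (X → ℝ)}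
    (hΨm : ∀ f ∈ Ψ, Measurable f) (hΨ : ∀ f ∈ Ψ, ∀ y, |f y| ≤ B) {N : ℕ → ℕ}
    {l u : ∀ j, Fin (N j) → X → ℝ} (hbr : IsBracketing P Ψ N l u) {G : ℕ → ℝ}
    (hG0 : ∀ j, 0 ≤ G j) (hG : ∀ j, Real.exp (G j) * N j ≤ Real.exp (G (j + 1))) (J : ℕ) :
    ∃ E : Set Ω, μ.real E ≤ 2 * Real.exp (-x) ∧ ∀ ω, ω ∉ E → ∀ f ∈ Ψ,
      ∑ τ ∈ Finset.Icc 1 t, w τ ω * f (O τ ω) * L τ ω ≤ 0 →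
        t * ∫ y, f y * ρ y ∂P ≤ chainBound B D x t G J + t * chainWidth B J := by
  obtain ⟨E, hE, ι, _, a, b, -, hab, hcov, hdev⟩ :=
    hs.exists_chain ht hD hB hx hxt hΨ hbr hG0 hG J
  refine ⟨E, hE.trans ?_, fun ω hω f hf hneg => ?_⟩
  · gcongr
    have : (0 : ℝ) < (1 / 2) ^ J := by positivity
    linarith
  · obtain ⟨i, hi⟩ := hcov f hf
    obtain ⟨h1, h2, h3, h4⟩ := hab i
    have h5 := hdev ω hω i
    have hB1 : ∀ y, |a i y| ≤ B := fun y =>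
      abs_le.2 ⟨(h3 y).1, (h3 y).2.1.trans (h3 y).2.2⟩
    -- Nonnegativity of weights and marks lets the sign pass from `f` to its lower bracket, whose
    -- deviation is the one controlled. The upper bracket enters only through the mean below.
    have h6 : ∑ τ ∈ Finset.Icc 1 t, w τ ω * a i (O τ ω) * L τ ω ≤ 0 :=
      (Finset.sum_le_sum fun τ hτ => by
        have := (hs.weight_mem τ hτ ω).1
        have := (hs.mark_mem τ hτ ω).1
        have := (hi (O τ ω)).1
        gcongr).trans hneg
    have hba : ∀ y, 0 ≤ b i y - a i y ∧ b i y - a i y ≤ 2 * B := fun y => by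
      have := h3 y
      constructor <;> linarith
    have h21 : Measurable fun y => b i y - a i y := h2.sub h1
    have ibm : Integrable (fun y => b i y - a i y) P :=
      integrable_of_measurable_of_abs_le h21 fun y => by
        rw [abs_of_nonneg (hba y).1]; exact (hba y).2
    have ibm2 : Integrable (fun y => (b i y - a i y) ^ 2) P :=
      integrable_of_measurable_of_abs_le (h21.pow_const 2) (M := (2 * B) ^ 2) fun y => by
        rw [abs_of_nonneg (sq_nonneg _)]
        exact pow_le_pow_left₀ (hba y).1 (hba y).2 2
    have h7 := integral_le_of_integral_sq_le (chainWidth_pos hB J) ibm ibm2 h4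
    have h8 : ∫ y, f y * ρ y ∂P ≤ ∫ y, (a i y * ρ y + (b i y - a i y)) ∂P := by
      refine integral_mono (hs.integrable_mul_density (hΨm f hf) (hΨ f hf))
        ((hs.integrable_mul_density h1 hB1).add ibm) fun y => ?_
      obtain ⟨r1, r2⟩ := hs.density_mem y
      have := hi y
      have := mul_le_mul_of_nonneg_left r2 (sub_nonneg.2 (hi y).1)
      simp only
      nlinarith
    rw [integral_add (hs.integrable_mul_density h1 hB1) ibm] at h8
    have h9 : deviation P ρ t w L O (a i) ω = t * ∫ y, a i y * ρ y ∂P -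
        ∑ τ ∈ Finset.Icc 1 t, w τ ω * a i (O τ ω) * L τ ω := by
      simp [deviation, Finset.sum_sub_distrib]
    have ht0 : (0 : ℝ) < t := by exact_mod_cast ht
    have := mul_le_mul_of_nonneg_left h8 ht0.le
    have := mul_le_mul_of_nonneg_left h7 ht0.le
    linarith

end IsWeightedSample


/-! ### The rate -/

/-- The exploration rate `t ^ (-(1/3 ∧ 1/(p+1)))`. -/
noncomputable def rate (p : ℝ) (t : ℕ) : ℝ := (t : ℝ) ^ (-(min (1 / 3 : ℝ) (1 / (p + 1))))

lemma rate_pos {p : ℝ} {t : ℕ} (ht : 1 ≤ t) : 0 < rate p t :=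
  Real.rpow_pos_of_pos (by exact_mod_cast ht) _

lemma min_exponent_pos {p : ℝ} (hp : 0 < p) : 0 < min (1 / 3 : ℝ) (1 / (p + 1)) := by
  positivity

lemma rate_antitone {p : ℝ} (hp : 0 < p) {s t : ℕ} (hs : 1 ≤ s) (hst : s ≤ t) :
    rate p t ≤ rate p s :=
  Real.rpow_le_rpow_of_nonpos (by exact_mod_cast hs) (by exact_mod_cast hst)
    (neg_nonpos.2 (min_exponent_pos hp).le)

lemma rate_one (p : ℝ) : rate p 1 = 1 := by simp [rate]

lemma rate_le_one {p : ℝ} (hp : 0 < p) {t : ℕ} (ht : 1 ≤ t) : rate p t ≤ 1 :=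
  (rate_antitone hp le_rfl ht).trans_eq (rate_one p)

lemma mul_rate_pow_three {p : ℝ} {t : ℕ} (ht : 1 ≤ t) :
    t * rate p t ^ 3 = (t : ℝ) ^ (1 - 3 * min (1 / 3 : ℝ) (1 / (p + 1))) := by
  have ht0 : (0 : ℝ) < t := by exact_mod_cast ht
  rw [rate, ← Real.rpow_mul_natCast ht0.le]
  nth_rewrite 1 [← Real.rpow_one (t : ℝ)]
  rw [← Real.rpow_add ht0]
  congr 1
  push_cast
  ring

/-- The exponent of the rate is at most `1/3`. This is the lower limit on exploration below which
the noise of order `√(t / δ)` would exceed `t δ`. -/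
lemma one_le_mul_rate_pow_three {p : ℝ} {t : ℕ} (ht : 1 ≤ t) : 1 ≤ t * rate p t ^ 3 := by
  rw [mul_rate_pow_three ht]
  refine Real.one_le_rpow (by exact_mod_cast ht) ?_
  have := min_le_left (1 / 3 : ℝ) (1 / (p + 1))
  linarith

/-- Induction on `t`. Bernoulli's inequality for the concave power `1 - a` gives `(t+1)^(1-a) -
t^(1-a) ≥ (1-a) (t+1)^(-a)`, and `1 - a ≥ 2/3` leaves room for the factor 2. -/
lemma sum_rate_le {p : ℝ} (hp : 0 < p) (t : ℕ) :
    ∑ τ ∈ Finset.Icc 1 t, rate p τ ≤ 2 * (t : ℝ) ^ (max (2 / 3 : ℝ) (p / (p + 1))) := by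
  set a := min (1 / 3 : ℝ) (1 / (p + 1)) with ha
  have ha0 : 0 < a := min_exponent_pos hp
  have ha1 : a ≤ 1 / 3 := min_le_left _ _
  have hexp : max (2 / 3 : ℝ) (p / (p + 1)) = 1 - a := by
    have h1 : p / (p + 1) = 1 - 1 / (p + 1) := by field_simp; ring
    have h2 : (2 / 3 : ℝ) = 1 - 1 / 3 := by norm_num
    rw [h1, h2, ha, max_sub_sub_left]
  rw [hexp]
  induction t with
  | zero => simp [Real.zero_rpow (by linarith : 1 - a ≠ 0)]
  | succ t ih =>
    rw [Finset.sum_Icc_succ_top (by omega)]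
    set y : ℝ := ((t + 1 : ℕ) : ℝ) with hy
    have hy1 : 1 ≤ y := by rw [hy]; push_cast; linarith [Nat.cast_nonneg (α := ℝ) t]
    have hy0 : 0 < y := by linarith
    have hty : (t : ℝ) = y * (1 + -(1 / y)) := by
      rw [hy]; push_cast; field_simp; ring
    have h1 : (1 + -(1 / y)) ^ (1 - a) ≤ 1 + (1 - a) * -(1 / y) := by
      have : 1 / y ≤ 1 := by rw [div_le_one hy0]; exact hy1
      exact rpow_one_add_le_one_add_mul_self (by linarith) (by linarith) (by linarith)
    have h2 : (t : ℝ) ^ (1 - a) ≤ y ^ (1 - a) * (1 + (1 - a) * -(1 / y)) := by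
      rw [hty, Real.mul_rpow hy0.le]
      · gcongr
      · have : 1 / y ≤ 1 := by rw [div_le_one hy0]; exact hy1
        linarith
    have h3 : rate p (t + 1) = y ^ (1 - a) * (1 / y) := by
      rw [rate, ← ha, ← hy, sub_eq_add_neg, Real.rpow_add hy0, Real.rpow_one]
      field_simp
    have h4 : 0 ≤ y ^ (1 - a) * (1 / y) := by positivity
    rw [h3]
    nlinarith

/-- A bound for the logarithm of the number of brackets after `j` steps of chaining. -/
noncomputable def entropySum (p c₀ : ℝ) (j : ℕ) : ℝ :=
  c₀ / ((2 : ℝ) ^ p - 1) * ((2 : ℝ) ^ p) ^ j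

lemma one_lt_two_rpow {p : ℝ} (hp : 0 < p) : 1 < (2 : ℝ) ^ p := Real.one_lt_rpow one_lt_two hp

lemma entropySum_nonneg {p c₀ : ℝ} (hp : 0 < p) (hc₀ : 0 < c₀) (j : ℕ) :
    0 ≤ entropySum p c₀ j := by
  have := one_lt_two_rpow hp
  have : 0 < (2 : ℝ) ^ p - 1 := by linarith
  unfold entropySum
  positivity

lemma entropySum_succ {p c₀ : ℝ} (hp : 0 < p) (j : ℕ) :
    entropySum p c₀ (j + 1) = entropySum p c₀ j + c₀ * ((2 : ℝ) ^ p) ^ j := by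
  have : (2 : ℝ) ^ p - 1 ≠ 0 := by have := one_lt_two_rpow hp; linarith
  unfold entropySum
  field_simp
  ring

lemma chainWidth_le {B : ℝ} (hB : 0 < B) (j : ℕ) :
    chainWidth B j ≤ (2 * B + 2) * (1 / 2) ^ j := by
  cases j with
  | zero => simp [chainWidth]
  | succ j =>
    have : (0 : ℝ) < (1 / 2) ^ j := by positivity
    rw [chainWidth, pow_succ]
    nlinarith

/-- Since `x ≥ 1`, the level of the `j`-th link is at most a constant times `x * 2^(p j)`. Its
square root times the width `2^(-j)` gives the ratio `2^(p/2 - 1)`. -/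
lemma chainBound_le {p c₀ B : ℝ} (hp : 0 < p) (hc₀ : 0 < c₀) (hB : 0 < B) :
    ∃ C : ℝ, 0 < C ∧ ∀ (D x : ℝ) (t J : ℕ), 0 ≤ D → 1 ≤ x →
      chainBound B D x t (entropySum p c₀) J ≤
        C * Real.sqrt (t * D * x) * (1 + ∑ j ∈ Finset.range J, ((2 : ℝ) ^ (p / 2 - 1)) ^ j) := by
  set R := (2 : ℝ) ^ p with hR
  have hR1 : 1 < R := one_lt_two_rpow hp
  set κ := c₀ / (R - 1) with hκ
  have hR2 : 0 < R - 1 := by linarith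
  have hκ0 : 0 < κ := by positivity
  -- The three summands absorb `x`, the entropy, and the term `(j + 1) * log 2`; the last grows only
  -- linearly and is bounded by `R ^ j` through Bernoulli's inequality.
  set C₂ := 1 + κ * R + (1 + 1 / (R - 1)) with hC₂
  have hC₂0 : 0 < C₂ := by positivity
  refine ⟨2 * B + (2 * B + 2) * Real.sqrt (2 * C₂), by positivity, fun D x t J hD hx => ?_⟩
  set S := Real.sqrt (t * D * x) with hS
  have hS0 : 0 ≤ S := Real.sqrt_nonneg _
  have hterm : ∀ j : ℕ, chainWidth B j * Real.sqrt (2 * t * D *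
      (x + entropySum p c₀ (j + 1) + (j + 1 : ℕ) * Real.log 2)) ≤
        (2 * B + 2) * Real.sqrt (2 * C₂) * S * ((2 : ℝ) ^ (p / 2 - 1)) ^ j := by
    intro j
    have hRj : 1 ≤ R ^ j := one_le_pow₀ hR1.le
    have hj : ((j + 1 : ℕ) : ℝ) * Real.log 2 ≤ (1 + 1 / (R - 1)) * R ^ j := by
      have h1 : 1 + (j : ℝ) * (R - 1) ≤ (1 + (R - 1)) ^ j :=
        one_add_mul_le_pow (by linarith) j
      rw [add_sub_cancel] at h1
      have h2 : (j : ℝ) ≤ 1 / (R - 1) * R ^ j := by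
        rw [one_div, inv_mul_eq_div, le_div_iff₀ hR2]; linarith
      have h3 : Real.log 2 ≤ 1 := by
        have := Real.log_le_sub_one_of_pos two_pos; linarith
      calc ((j + 1 : ℕ) : ℝ) * Real.log 2 ≤ ((j + 1 : ℕ) : ℝ) * 1 := by gcongr
        _ = 1 + (j : ℝ) := by push_cast; ring
        _ ≤ R ^ j + 1 / (R - 1) * R ^ j := add_le_add hRj h2
        _ = _ := by ring
    have hsum : x + entropySum p c₀ (j + 1) + (j + 1 : ℕ) * Real.log 2 ≤ x * (C₂ * R ^ j) := by
      have he : entropySum p c₀ (j + 1) = κ * R * R ^ j := by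
        rw [entropySum, pow_succ]; ring
      have h5 : 0 ≤ κ * R * R ^ j + (1 + 1 / (R - 1)) * R ^ j := by positivity
      have h6 : x ≤ x * R ^ j := le_mul_of_one_le_right (by linarith) hRj
      have h7 := le_mul_of_one_le_left h5 hx
      rw [he, hC₂]
      nlinarith
    have hsq : Real.sqrt (R ^ j) = ((2 : ℝ) ^ (p / 2)) ^ j := by
      rw [Real.sqrt_eq_iff_mul_self_eq (by positivity) (by positivity), ← mul_pow,
        ← Real.rpow_add two_pos, add_halves]
    calc chainWidth B j * Real.sqrt (2 * t * D *
          (x + entropySum p c₀ (j + 1) + (j + 1 : ℕ) * Real.log 2))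
        ≤ (2 * B + 2) * (1 / 2) ^ j * Real.sqrt (2 * t * D * (x * (C₂ * R ^ j))) := by
          gcongr
          exact chainWidth_le hB j
      _ = (2 * B + 2) * (1 / 2) ^ j * (Real.sqrt (2 * C₂) * S * ((2 : ℝ) ^ (p / 2)) ^ j) := by
          rw [hS, ← hsq, ← Real.sqrt_mul (by positivity), ← Real.sqrt_mul (by positivity)]
          congr 2; ring
      _ = _ := by
          rw [Real.rpow_sub two_pos, Real.rpow_one, div_pow, div_pow, one_pow]
          field_simp
  have hsum0 : 0 ≤ ∑ j ∈ Finset.range J, ((2 : ℝ) ^ (p / 2 - 1)) ^ j :=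
    Finset.sum_nonneg fun _ _ => by positivity
  calc chainBound B D x t (entropySum p c₀) J
      ≤ B * (2 * S) + ∑ j ∈ Finset.range J,
          (2 * B + 2) * Real.sqrt (2 * C₂) * S * ((2 : ℝ) ^ (p / 2 - 1)) ^ j :=
        add_le_add le_rfl (Finset.sum_le_sum fun j _ => hterm j)
    _ = 2 * B * S * 1 + (2 * B + 2) * Real.sqrt (2 * C₂) * S *
          ∑ j ∈ Finset.range J, ((2 : ℝ) ^ (p / 2 - 1)) ^ j := by
        rw [Finset.mul_sum]; ring
    _ ≤ _ := by
        have h1 : 0 ≤ 2 * B * S * ∑ j ∈ Finset.range J, ((2 : ℝ) ^ (p / 2 - 1)) ^ j := by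
          positivity
        have h2 : 0 ≤ (2 * B + 2) * Real.sqrt (2 * C₂) * S := by positivity
        nlinarith

/-- For `p < 2` the geometric series converges and `t δ³ ≥ 1` suffices. For `p > 2` its last term
dominates and is controlled by the choice of `m`. At `p = 2` the ratio is 1 and the sum is not
bounded by a constant times the right side. -/
lemma geom_sum_le {p : ℝ} (hp2 : p ≠ 2) : ∃ C : ℝ, 0 < C ∧ ∀ t : ℕ, 1 ≤ t → ∀ m : ℕ,
    (2 : ℝ) ^ m ≤ 1 / rate p t →
      1 + ∑ j ∈ Finset.range (m + 2), ((2 : ℝ) ^ (p / 2 - 1)) ^ j ≤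
        C * Real.sqrt (t * rate p t ^ 3) := by
  set r := (2 : ℝ) ^ (p / 2 - 1) with hr
  have hr0 : 0 < r := by positivity
  rcases lt_or_gt_of_ne hp2 with h | h
  · have hr1 : r < 1 := Real.rpow_lt_one_of_one_lt_of_neg one_lt_two (by linarith)
    have hr2 : 0 < 1 - r := by linarith
    refine ⟨1 + 1 / (1 - r), by positivity, fun t ht m hm => ?_⟩
    have h1 : 1 ≤ Real.sqrt (t * rate p t ^ 3) :=
      Real.one_le_sqrt.2 (one_le_mul_rate_pow_three ht)
    have h2 : ∑ j ∈ Finset.range (m + 2), r ^ j ≤ 1 / (1 - r) := by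
      rw [geom_sum_eq hr1.ne, ← neg_div_neg_eq, neg_sub, neg_sub]
      have : 0 < r ^ (m + 2) := by positivity
      gcongr
      linarith
    have h3 : 0 < 1 + 1 / (1 - r) := by positivity
    nlinarith
  · have hr1 : 1 < r := Real.one_lt_rpow one_lt_two (by linarith)
    have hr2 : 0 < r - 1 := by linarith
    refine ⟨1 + r ^ 2 / (r - 1), by positivity, fun t ht m hm => ?_⟩
    have h1 : 1 ≤ Real.sqrt (t * rate p t ^ 3) :=
      Real.one_le_sqrt.2 (one_le_mul_rate_pow_three ht)
    have h2 : ∑ j ∈ Finset.range (m + 2), r ^ j ≤ r ^ 2 / (r - 1) * r ^ m := by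
      rw [geom_sum_eq hr1.ne', div_mul_eq_mul_div, ← pow_add, add_comm 2 m]
      gcongr
      linarith
    have ht0 : (0 : ℝ) < t := by exact_mod_cast ht
    have h3 : r ^ m ≤ Real.sqrt (t * rate p t ^ 3) := by
      have hmin : min (1 / 3 : ℝ) (1 / (p + 1)) = 1 / (p + 1) :=
        min_eq_right (one_div_le_one_div_of_le (by norm_num) (by linarith))
      have e1 : r ^ m = ((2 : ℝ) ^ m) ^ (p / 2 - 1) := by
        rw [hr, ← Real.rpow_natCast, ← Real.rpow_natCast, ← Real.rpow_mul two_pos.le,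
          ← Real.rpow_mul two_pos.le, mul_comm]
      -- For `p > 2` one has `t * δ ^ (p + 1) = 1`, hence `t * δ ^ 3 = δ ^ (2 - p)`.
      have e2 : Real.sqrt (t * rate p t ^ 3) = (1 / rate p t) ^ (p / 2 - 1) := by
        rw [mul_rate_pow_three ht, rate, hmin, Real.sqrt_eq_rpow, ← Real.rpow_mul ht0.le,
          one_div (_ ^ _), ← Real.rpow_neg ht0.le, ← Real.rpow_mul ht0.le]
        congr 1
        have : p + 1 ≠ 0 := by linarith
        field_simp
        ring
      rw [e1, e2]
      exact Real.rpow_le_rpow (by positivity) hm (by linarith)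
    have h4 : 0 < r ^ 2 / (r - 1) := by positivity
    nlinarith

/-- With the right number of steps, chaining gives the rate of exploration. -/
theorem exists_chain_rate {p c₀ B : ℝ} (hp : 0 < p) (hp2 : p ≠ 2) (hc₀ : 0 < c₀) (hB : 0 < B) :
    ∃ C : ℝ, 0 < C ∧ ∀ (t : ℕ) (x : ℝ), 1 ≤ t → 1 ≤ x → ∃ J : ℕ,
      chainBound B (1 / rate p t) x t (entropySum p c₀) J + t * chainWidth B J ≤
        t * (C * rate p t * Real.sqrt x) := by
  obtain ⟨C₁, hC₁, h₁⟩ := chainBound_le (c₀ := c₀) hp hc₀ hB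
  obtain ⟨C₂, hC₂, h₂⟩ := geom_sum_le hp2
  refine ⟨C₁ * C₂ + 1, by positivity, fun t x ht hx => ?_⟩
  have hd := rate_pos (p := p) ht
  have hd1 := rate_le_one hp ht
  have ht0 : (0 : ℝ) < t := by exact_mod_cast ht
  obtain ⟨m, hm1, hm2⟩ := exists_nat_pow_near ((one_le_div hd).2 hd1) one_lt_two
  -- With `2 ^ m ≤ 1 / δ < 2 ^ (m + 1)`, the width after `m + 2` steps is `2 ^ (-(m + 1)) ≤ δ`:
  -- `chainWidth` lags one scale behind its index.
  refine ⟨m + 2, ?_⟩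
  set d := rate p t
  have hw : chainWidth B (m + 2) ≤ d := by
    rw [chainWidth, div_pow, one_pow, one_div]
    rw [one_div] at hm2
    exact inv_le_of_inv_le₀ hd hm2.le
  have hsx : 1 ≤ Real.sqrt x := Real.one_le_sqrt.2 hx
  have hprod : Real.sqrt (t * (1 / d) * x) * Real.sqrt (t * d ^ 3) = t * d * Real.sqrt x := by
    rw [← Real.sqrt_mul (by positivity)]
    have : t * (1 / d) * x * (t * d ^ 3) = (t * d) ^ 2 * x := by field_simp
    rw [this, Real.sqrt_mul (by positivity), Real.sqrt_sq (by positivity)]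
  calc chainBound B (1 / d) x t (entropySum p c₀) (m + 2) + t * chainWidth B (m + 2)
      ≤ C₁ * Real.sqrt (t * (1 / d) * x) * (C₂ * Real.sqrt (t * d ^ 3)) + t * d := by
        refine add_le_add ((h₁ _ x t (m + 2) (by positivity) hx).trans ?_) (by gcongr)
        gcongr
        exact h₂ t ht m hm1
    _ = C₁ * C₂ * (t * d * Real.sqrt x) + t * d * 1 := by rw [← hprod]; ring
    _ ≤ C₁ * C₂ * (t * d * Real.sqrt x) + t * d * Real.sqrt x := by gcongr
    _ = _ := by ring


/-! ### One step of the algorithm -/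

/-- A bounded function that is known given `m₀` can be taken out of a conditional mean. -/
lemma integral_mul_of_condExp_eq {Ω : Type*} {m₀ : MeasurableSpace Ω} [m : MeasurableSpace Ω]
    {μ : Measure Ω} [IsFiniteMeasure μ] (hm₀ : m₀ ≤ m) {X Y Q : Ω → ℝ} (hX : Measurable[m₀] X)
    {M : ℝ} (hM : ∀ ω, |X ω| ≤ M) (hY : Integrable Y μ) (hQ : μ[Y | m₀] =ᵐ[μ] Q) :
    ∫ ω, X ω * Y ω ∂μ = ∫ ω, X ω * Q ω ∂μ := by
  have hprod : Integrable (X * Y) μ := by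
    rw [mul_comm]
    exact hY.mul_of_abs_le (hX.mono hm₀ le_rfl) hM
  have h1 := condExp_mul_of_stronglyMeasurable_left hX.stronglyMeasurable hprod hY
  refine (integral_condExp hm₀).symm.trans (integral_congr_ae ?_)
  filter_upwards [h1, hQ] with ω h1 h2
  refine h1.trans ?_
  rw [Pi.mul_apply, h2]

lemma measurable_comp_past {Ω X : Type*} {m₀ m₁ : MeasurableSpace Ω} [MeasurableSpace X]
    (hm : m₀ ≤ m₁) {f : Ω → X} (hf : Measurable[m₁] f) {G : Ω × X → ℝ}
    (hG : Measurable[m₀.prod inferInstance] G) : Measurable[m₁] fun ω => G (ω, f ω) :=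
  hG.comp ((measurable_id'' hm).prodMk hf)

/-- Split according to the action, replace each indicator by its conditional probability, then use
that the past and the context have a product law and apply Fubini. The past is a random element `H`
of a separate space `S`, so that product measurability does not involve two σ-algebras on the same
type. -/
lemma integral_comp_action_aux {Ω S C : Type*} {K : ℕ} [m : MeasurableSpace Ω]
    [mS : MeasurableSpace S] [MeasurableSpace C] {μ : Measure Ω} [IsProbabilityMeasure μ]
    {PW : Measure C} [IsProbabilityMeasure PW] {H : Ω → S} {V : Ω → C} {A : Ω → Fin K}
    (hH : Measurable H) (hV : Measurable V) (hA : Measurable A) (hlaw : μ.map V = PW)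
    (hind : Indep (MeasurableSpace.comap H mS) (MeasurableSpace.comap V inferInstance) μ)
    {g : S × (Fin K × C) → ℝ} (hg : Measurable g) (hg01 : ∀ x, 0 ≤ g x ∧ g x ≤ 1)
    (hact : ∀ a : Fin K, μ[Set.indicator (A ⁻¹' {a}) (fun _ => (1 : ℝ)) |
        MeasurableSpace.comap H mS ⊔ MeasurableSpace.comap V inferInstance]
      =ᵐ[μ] fun ω => g (H ω, (a, V ω)))
    {G : S × (Fin K × C) → ℝ} (hG : Measurable G) {M : ℝ} (hM : ∀ x, |G x| ≤ M) :
    ∫ ω, G (H ω, (A ω, V ω)) ∂μ =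
      ∫ ω, ∫ c, ∑ a, g (H ω, (a, c)) * G (H ω, (a, c)) ∂PW ∂μ := by
  have hm1 : MeasurableSpace.comap H mS ⊔ MeasurableSpace.comap V inferInstance ≤ m :=
    sup_le hH.comap_le hV.comap_le
  have hmap : μ.map (fun ω => (H ω, V ω)) = (μ.map H).prod PW := by
    rw [← hlaw]
    exact (indepFun_iff_map_prod_eq_prod_map_map hH.aemeasurable hV.aemeasurable).1 hind
  have hHV : Measurable[MeasurableSpace.comap H mS ⊔ MeasurableSpace.comap V inferInstance]
      (fun ω => (H ω, V ω)) :=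
    ((comap_measurable H).mono le_sup_left le_rfl).prodMk
      ((comap_measurable V).mono le_sup_right le_rfl)
  have : IsProbabilityMeasure (μ.map H) := Measure.isProbabilityMeasure_map hH.aemeasurable
  have hGa : ∀ a : Fin K, Measurable fun y : S × C => G (y.1, (a, y.2)) := fun a =>
    hG.comp (measurable_fst.prodMk (measurable_const.prodMk measurable_snd))
  have hga : ∀ a : Fin K, Measurable fun y : S × C => g (y.1, (a, y.2)) := fun a =>
    hg.comp (measurable_fst.prodMk (measurable_const.prodMk measurable_snd))
  have hprodI : ∀ a : Fin K, Integrable (fun y : S × C => g (y.1, (a, y.2)) * G (y.1, (a, y.2)))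
      ((μ.map H).prod PW) := fun a =>
    (integrable_of_measurable_of_abs_le (hga a) (M := 1) fun y =>
      abs_le.2 ⟨by linarith [(hg01 (y.1, (a, y.2))).1], (hg01 _).2⟩).mul_of_abs_le (hGa a)
      fun y => hM _
  have hsetm : ∀ a : Fin K, MeasurableSet (A ⁻¹' {a}) := fun a => hA (measurableSet_singleton a)
  have hindI : ∀ a : Fin K, Integrable (Set.indicator (A ⁻¹' {a}) (fun _ => (1 : ℝ))) μ :=
    fun a => (integrable_const _).indicator (hsetm a)
  have hterm : ∀ a : Fin K,
      ∫ ω, Set.indicator (A ⁻¹' {a}) (fun _ => (1 : ℝ)) ω * G (H ω, (a, V ω)) ∂μ =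
        ∫ y, g (y.1, (a, y.2)) * G (y.1, (a, y.2)) ∂((μ.map H).prod PW) := by
    intro a
    have h2 : ∫ ω, Set.indicator (A ⁻¹' {a}) (fun _ => (1 : ℝ)) ω * G (H ω, (a, V ω)) ∂μ =
        ∫ ω, g (H ω, (a, V ω)) * G (H ω, (a, V ω)) ∂μ := by
      simp only [mul_comm _ (G _)]
      exact integral_mul_of_condExp_eq hm1 ((hGa a).comp hHV) (fun ω => hM _) (hindI a) (hact a)
    rw [h2, ← hmap]
    exact (integral_map (hH.prodMk hV).aemeasurable
      (f := fun y : S × C => g (y.1, (a, y.2)) * G (y.1, (a, y.2)))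
      ((hga a).mul (hGa a)).aestronglyMeasurable).symm
  calc ∫ ω, G (H ω, (A ω, V ω)) ∂μ
      = ∫ ω, ∑ a, Set.indicator (A ⁻¹' {a}) (fun _ => (1 : ℝ)) ω * G (H ω, (a, V ω)) ∂μ := by
        classical
        refine integral_congr_ae (Filter.Eventually.of_forall fun ω => ?_)
        simp only [Set.indicator_apply, Set.mem_preimage, Set.mem_singleton_iff, ite_mul, one_mul,
          zero_mul, Finset.sum_ite_eq, Finset.mem_univ, if_true]
    _ = ∑ a, ∫ y, g (y.1, (a, y.2)) * G (y.1, (a, y.2)) ∂((μ.map H).prod PW) := by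
        rw [integral_finsetSum]
        · exact Finset.sum_congr rfl fun a _ => hterm a
        · exact fun a _ =>
            (hindI a).mul_of_abs_le ((hGa a).comp (hH.prodMk hV)) fun ω => hM _
    _ = ∫ y, ∑ a, g (y.1, (a, y.2)) * G (y.1, (a, y.2)) ∂((μ.map H).prod PW) :=
        (integral_finsetSum _ fun a _ => hprodI a).symm
    _ = ∫ s, ∫ c, ∑ a, g (s, (a, c)) * G (s, (a, c)) ∂PW ∂(μ.map H) :=
        integral_prod _ (integrable_finsetSum _ fun a _ => hprodI a)
    _ = _ := by
        rw [integral_map hH.aemeasurable]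
        exact (Finset.measurable_sum _ fun a _ =>
          (hga a).mul (hGa a)).stronglyMeasurable.integral_prod_right.aestronglyMeasurable

/-- Given the past `m₀`, the context has law `PW` and the action is drawn from `g`. -/
lemma integral_comp_action {Ω C : Type*} {K : ℕ} {m₀ : MeasurableSpace Ω} [m : MeasurableSpace Ω]
    [MeasurableSpace C] {μ : Measure Ω} [IsProbabilityMeasure μ]
    {PW : Measure C} [IsProbabilityMeasure PW] (hm₀ : m₀ ≤ m)
    {V : Ω → C} {A : Ω → Fin K} (hV : Measurable V) (hA : Measurable A) (hlaw : μ.map V = PW)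
    (hind : Indep m₀ (MeasurableSpace.comap V inferInstance) μ)
    {g : Ω × (Fin K × C) → ℝ} (hg : Measurable[m₀.prod inferInstance] g)
    (hg01 : ∀ x, 0 ≤ g x ∧ g x ≤ 1)
    (hact : ∀ a : Fin K, μ[Set.indicator (A ⁻¹' {a}) (fun _ => (1 : ℝ)) |
        m₀ ⊔ MeasurableSpace.comap V inferInstance]
      =ᵐ[μ] fun ω => g (ω, (a, V ω)))
    {G : Ω × (Fin K × C) → ℝ} (hG : Measurable[m₀.prod inferInstance] G) {M : ℝ}
    (hM : ∀ x, |G x| ≤ M) :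
    ∫ ω, G (ω, (A ω, V ω)) ∂μ = ∫ ω, ∫ c, ∑ a, g (ω, (a, c)) * G (ω, (a, c)) ∂PW ∂μ := by
  -- The past is the identity map from `Ω` with `m` to `Ω` with the smaller σ-algebra `m₀`.
  refine @integral_comp_action_aux Ω Ω C K m m₀ _ μ _ PW _ id V A (measurable_id'' hm₀) hV hA
    hlaw ?_ g hg hg01 ?_ G hG M hM
  · rwa [MeasurableSpace.comap_id]
  · rwa [MeasurableSpace.comap_id]

lemma integral_refLaw {K d : ℕ} (hK : 0 < K) (PW : Measure (Ctx d)) [IsProbabilityMeasure PW]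
    {h : Fin K × Ctx d → ℝ} (hh : Measurable h) {M : ℝ} (hM : ∀ x, |h x| ≤ M) :
    ∫ x, h x ∂(refLaw K PW) = ∫ w, ∑ a, (K : ℝ)⁻¹ * h (a, w) ∂PW := by
  have : Nonempty (Fin K) := ⟨⟨0, hK⟩⟩
  have : IsProbabilityMeasure (uniformOn (Set.univ : Set (Fin K))) :=
    isProbabilityMeasure_uniformOn Set.finite_univ Set.univ_nonempty
  have hI : ∀ a, Integrable (fun w => h (a, w)) PW := fun a =>
    integrable_of_measurable_of_abs_le (hh.comp (measurable_const.prodMk measurable_id))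
      fun w => hM _
  have hu : ∀ a : Fin K, (uniformOn (Set.univ : Set (Fin K))).real {a} = (K : ℝ)⁻¹ := by
    intro a
    simp [Measure.real, uniformOn_univ]
  rw [refLaw, integral_prod _ (integrable_of_measurable_of_abs_le hh hM),
    integral_fintype (Integrable.of_finite), integral_finsetSum _ fun a _ => (hI a).const_mul _]
  exact Finset.sum_congr rfl fun a _ => by rw [hu, integral_const_mul, smul_eq_mul]

lemma isProbabilityMeasure_refLaw {K d : ℕ} (hK : 0 < K) (PW : Measure (Ctx d))
    [IsProbabilityMeasure PW] : IsProbabilityMeasure (refLaw K PW) := by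
  have : Nonempty (Fin K) := ⟨⟨0, hK⟩⟩
  have : IsProbabilityMeasure (uniformOn (Set.univ : Set (Fin K))) :=
    isProbabilityMeasure_uniformOn Set.finite_univ Set.univ_nonempty
  unfold refLaw
  infer_instance

/-! ### Measurability with respect to the history. -/

section History

set_option linter.unusedSectionVars false

variable {Ω : Type*} [m : MeasurableSpace Ω] {K d : ℕ} {W : ℕ → Ω → Ctx d} {A : ℕ → Ω → Fin K}
  {Y : ℕ → Ω → ℝ}

lemma history_mono : Monotone (history W A Y) := fun _ _ hst =>
  biSup_mono fun _ hi => ⟨hi.1, hi.2.trans hst⟩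

lemma history_le (hW : ∀ t, Measurable (W t)) (hA : ∀ t, Measurable (A t))
    (hY : ∀ t, Measurable (Y t)) (t : ℕ) : history W A Y t ≤ m :=
  iSup₂_le fun i _ => sup_le (sup_le (hW i).comap_le (hA i).comap_le) (hY i).comap_le

lemma observation_le_history {t : ℕ} (ht : 1 ≤ t) :
    MeasurableSpace.comap (W t) inferInstance ⊔ MeasurableSpace.comap (A t) inferInstance ⊔
      MeasurableSpace.comap (Y t) inferInstance ≤ history W A Y t :=
  le_iSup₂ (f := fun i (_ : i ∈ Set.Icc 1 t) => MeasurableSpace.comap (W i) inferInstance ⊔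
    MeasurableSpace.comap (A i) inferInstance ⊔ MeasurableSpace.comap (Y i) inferInstance) t
    ⟨ht, le_rfl⟩

lemma measurable_context_history {t : ℕ} (ht : 1 ≤ t) : Measurable[history W A Y t] (W t) :=
  (comap_measurable _).mono ((le_sup_left.trans le_sup_left).trans (observation_le_history ht))
    le_rfl

lemma measurable_action_history {t : ℕ} (ht : 1 ≤ t) : Measurable[history W A Y t] (A t) :=
  (comap_measurable _).mono ((le_sup_right.trans le_sup_left).trans (observation_le_history ht))
    le_rfl

lemma measurable_reward_history {t : ℕ} (ht : 1 ≤ t) : Measurable[history W A Y t] (Y t) :=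
  (comap_measurable _).mono (le_sup_right.trans (observation_le_history ht)) le_rfl

end History

/-- The policies computed from the regressors are probability vectors that depend measurably on
the past. -/
structure HasPolicies {Ω : Type*} {K d : ℕ} (pmap : Regressor K d → Regressor K d)
    (W : ℕ → Ω → Ctx d) (A : ℕ → Ω → Fin K) (Y : ℕ → Ω → ℝ) (fhat : ℕ → Ω → Regressor K d) :
    Prop where
  measurable : ∀ t, 1 ≤ t → Measurable[(history W A Y t).prod inferInstance]
    (fun x : Ω × (Fin K × Ctx d) => pmap (fhat t x.1) x.2)
  mem_stdSimplex : ∀ t, 1 ≤ t → ∀ ω w, (fun a => pmap (fhat t ω) (a, w)) ∈ stdSimplex ℝ (Fin K)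

/-! ### The design as a probability vector bounded below by the exploration rate. -/

namespace HasPolicies

variable {Ω : Type*} {K d : ℕ} {pmap : Regressor K d → Regressor K d}
  {W : ℕ → Ω → Ctx d} {A : ℕ → Ω → Fin K} {Y : ℕ → Ω → ℝ} {fhat : ℕ → Ω → Regressor K d}

lemma currentPolicy_mem (hπ : HasPolicies pmap W A Y fhat) (hK : 0 < K) (t : ℕ) (ω : Ω)
    (w : Ctx d) : (fun a => currentPolicy pmap fhat t ω (a, w)) ∈ stdSimplex ℝ (Fin K) := by
  unfold currentPolicy
  split_ifs with h
  · refine ⟨fun _ => by positivity, ?_⟩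
    have : (K : ℝ) ≠ 0 := by positivity
    simp [this]
  · exact hπ.mem_stdSimplex t (by omega) ω w

lemma measurable_currentPolicy (hπ : HasPolicies pmap W A Y fhat) (t : ℕ) :
    Measurable[(history W A Y t).prod inferInstance]
      (fun x : Ω × (Fin K × Ctx d) => currentPolicy pmap fhat t x.1 x.2) := by
  unfold currentPolicy
  split_ifs with h
  · exact measurable_const
  · exact hπ.measurable t (by omega)

variable {δ : ℕ → ℝ}

lemma measurable_design (hπ : HasPolicies pmap W A Y fhat) (t : ℕ) :
    Measurable[(history W A Y (t - 1)).prod inferInstance]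
      (fun x : Ω × (Fin K × Ctx d) => design pmap δ fhat t x.1 x.2) := by
  unfold design
  exact ((hπ.measurable_currentPolicy (t - 1)).const_mul _).const_add _

lemma le_design (hπ : HasPolicies pmap W A Y fhat) (hK : 0 < K) {t : ℕ} (h1 : δ t ≤ 1) (ω : Ω)
    (x : Fin K × Ctx d) : δ t * (K : ℝ)⁻¹ ≤ design pmap δ fhat t ω x := by
  have := (hπ.currentPolicy_mem hK (t - 1) ω x.2).1 x.1
  unfold design
  exact le_add_of_nonneg_right (mul_nonneg (by linarith) this)

lemma sum_design (hπ : HasPolicies pmap W A Y fhat) (hK : 0 < K) (t : ℕ) (ω : Ω)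
    (w : Ctx d) : ∑ a, design pmap δ fhat t ω (a, w) = 1 := by
  have h := (hπ.currentPolicy_mem hK (t - 1) ω w).2
  have : (K : ℝ) ≠ 0 := by positivity
  simp only [design, Finset.sum_add_distrib, ← Finset.mul_sum]
  rw [h]
  simp [this]

lemma design_mem (hπ : HasPolicies pmap W A Y fhat) (hK : 0 < K) {t : ℕ} (h0 : 0 < δ t)
    (h1 : δ t ≤ 1) (ω : Ω) (x : Fin K × Ctx d) :
    0 < design pmap δ fhat t ω x ∧ design pmap δ fhat t ω x ≤ 1 := by
  have hpos : ∀ x, 0 < design pmap δ fhat t ω x := fun x =>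
    lt_of_lt_of_le (by positivity) (hπ.le_design hK h1 ω x)
  refine ⟨hpos x, ?_⟩
  rw [← hπ.sum_design (δ := δ) hK t ω x.2]
  exact Finset.single_le_sum (f := fun a => design pmap δ fhat t ω (a, x.2))
    (fun a _ => (hpos _).le) (Finset.mem_univ x.1)

end HasPolicies

/-! ### Conditional means along a run. -/

namespace IsRun

set_option linter.unusedSectionVars false

variable {Ω : Type*} [m : MeasurableSpace Ω] {μ : Measure Ω} [IsProbabilityMeasure μ] {K d : ℕ}
  {PW : Measure (Ctx d)} [IsProbabilityMeasure PW] {q : Fin K × Ctx d → ℝ} {φ : ℝ → ℝ}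
  {F : Set (Regressor K d)} {pmap : Regressor K d → Regressor K d} {δ : ℕ → ℝ}
  {W : ℕ → Ω → Ctx d} {A : ℕ → Ω → Fin K} {Y : ℕ → Ω → ℝ} {fhat : ℕ → Ω → Regressor K d}

lemma reward_mem_Icc (hrun : IsRun μ PW q φ F pmap δ W A Y fhat) (t : ℕ) (ω : Ω) :
    0 ≤ Y t ω ∧ Y t ω ≤ 1 := by
  rcases hrun.reward_mem t ω with h | h <;> rw [h] <;> norm_num

lemma history_le (hrun : IsRun μ PW q φ F pmap δ W A Y fhat) (t : ℕ) : history W A Y t ≤ m :=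
  EpsGreedy.history_le hrun.measurable_context hrun.measurable_action hrun.measurable_reward t

/-- The conditional mean of a function of the past, of the action and of the context. -/
lemma integral_action (hrun : IsRun μ PW q φ F pmap δ W A Y fhat)
    (hπ : HasPolicies pmap W A Y fhat) (hK : 0 < K) {t : ℕ} (ht : 1 ≤ t) (h0 : 0 < δ t)
    (h1 : δ t ≤ 1) {G : Ω × (Fin K × Ctx d) → ℝ}
    (hG : Measurable[(history W A Y (t - 1)).prod inferInstance] G) {M : ℝ}
    (hM : ∀ x, |G x| ≤ M) :
    ∫ ω, G (ω, (A t ω, W t ω)) ∂μ =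
      ∫ ω, ∫ c, ∑ a, design pmap δ fhat t ω (a, c) * G (ω, (a, c)) ∂PW ∂μ :=
  integral_comp_action (g := fun x => design pmap δ fhat t x.1 x.2)
    (hrun.history_le (t - 1)) (hrun.measurable_context t)
    (hrun.measurable_action t) (hrun.context_law t ht) (hrun.context_indep t ht)
    (hπ.measurable_design t)
    (fun x => ⟨(hπ.design_mem hK h0 h1 x.1 x.2).1.le, (hπ.design_mem hK h0 h1 x.1 x.2).2⟩)
    (hrun.action_law t ht) hG hM

lemma integral_mul_reward (hrun : IsRun μ PW q φ F pmap δ W A Y fhat)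
    {t : ℕ} (ht : 1 ≤ t) {G : Ω × (Fin K × Ctx d) → ℝ}
    (hG : Measurable[(history W A Y (t - 1)).prod inferInstance] G) {M : ℝ}
    (hM : ∀ x, |G x| ≤ M) :
    ∫ ω, G (ω, (A t ω, W t ω)) * Y t ω ∂μ =
      ∫ ω, G (ω, (A t ω, W t ω)) * q (A t ω, W t ω) ∂μ := by
  refine integral_mul_of_condExp_eq (sup_le (sup_le (hrun.history_le _)
    (hrun.measurable_context t).comap_le) (hrun.measurable_action t).comap_le) ?_ (fun ω => hM _)
    ?_ (hrun.reward_law t ht)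
  · exact measurable_comp_past (le_sup_left.trans le_sup_left)
      (((comap_measurable _).mono le_sup_right le_rfl).prodMk
        ((comap_measurable _).mono (le_sup_right.trans le_sup_left) le_rfl)) hG
  · refine integrable_of_measurable_of_abs_le (hrun.measurable_reward t) (M := 1) fun ω => ?_
    have := hrun.reward_mem_Icc t ω
    rw [abs_of_nonneg this.1]; exact this.2

lemma measurable_past_prod {t : ℕ} {Z : Ω → ℝ} (hZ : Measurable[history W A Y t] Z) :
    Measurable[(history W A Y t).prod inferInstance] fun x : Ω × (Fin K × Ctx d) => Z x.1 :=
  hZ.comp (@measurable_fst _ _ (history W A Y t) _)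

lemma measurable_snd_prod {t : ℕ} {h : Fin K × Ctx d → ℝ} (hh : Measurable h) :
    Measurable[(history W A Y t).prod inferInstance] fun x : Ω × (Fin K × Ctx d) => h x.2 :=
  hh.comp (@measurable_snd _ _ (history W A Y t) _)

lemma abs_weighted_le (hπ : HasPolicies pmap W A Y fhat) (hK : 0 < K) {t : ℕ} (h0 : 0 < δ t)
    (h1 : δ t ≤ 1) (ω : Ω) (x : Fin K × Ctx d) :
    0 ≤ (K : ℝ)⁻¹ / design pmap δ fhat t ω x ∧
      (K : ℝ)⁻¹ / design pmap δ fhat t ω x ≤ 1 / δ t := by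
  have hg := (hπ.design_mem hK h0 h1 ω x).1
  have := hπ.le_design hK h1 ω x
  refine ⟨by positivity, ?_⟩
  rw [div_le_div_iff₀ hg h0]
  linarith

/-- Importance weighting: `K⁻¹ / g` cancels the probability `g` with which the action is drawn and
leaves the uniform weight `K⁻¹`, whatever policy the past produced. -/
lemma integral_weighted (hrun : IsRun μ PW q φ F pmap δ W A Y fhat)
    (hπ : HasPolicies pmap W A Y fhat) (hK : 0 < K) {t : ℕ} (ht : 1 ≤ t) (h0 : 0 < δ t)
    (h1 : δ t ≤ 1) {Z : Ω → ℝ} (hZ : Measurable[history W A Y (t - 1)] Z)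
    {M : ℝ} (hZM : ∀ ω, |Z ω| ≤ M) {h : Fin K × Ctx d → ℝ} (hh : Measurable h) {M' : ℝ}
    (hM' : ∀ x, |h x| ≤ M') :
    ∫ ω, Z ω * ((K : ℝ)⁻¹ / design pmap δ fhat t ω (A t ω, W t ω) * h (A t ω, W t ω)) ∂μ =
      (∫ ω, Z ω ∂μ) * ∫ x, h x ∂(refLaw K PW) := by
  have hG : Measurable[(history W A Y (t - 1)).prod inferInstance]
      fun x : Ω × (Fin K × Ctx d) =>
        Z x.1 * ((K : ℝ)⁻¹ / design pmap δ fhat t x.1 x.2 * h x.2) :=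
    (measurable_past_prod hZ).mul
      (((hπ.measurable_design t).const_div _).mul (measurable_snd_prod hh))
  have := hrun.integral_action hπ hK ht h0 h1 hG (M := M * (1 / δ t * M')) fun x => by
    obtain ⟨g1, g2⟩ := abs_weighted_le hπ hK h0 h1 x.1 x.2
    rw [abs_mul, abs_mul, abs_of_nonneg g1]
    have hZ0 := (abs_nonneg _).trans (hZM x.1)
    exact mul_le_mul (hZM _) (mul_le_mul g2 (hM' _) (abs_nonneg _) (by positivity))
      (by positivity) hZ0
  refine this.trans ?_
  rw [integral_refLaw hK PW hh hM', ← integral_mul_const]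
  refine integral_congr_ae (Filter.Eventually.of_forall fun ω => ?_)
  simp only
  rw [← integral_const_mul]
  refine integral_congr_ae (Filter.Eventually.of_forall fun c => ?_)
  simp only
  rw [Finset.mul_sum]
  refine Finset.sum_congr rfl fun a _ => ?_
  have := (hπ.design_mem hK h0 h1 ω (a, c)).1
  field_simp

/-- The reward may be replaced by its conditional mean `q`, since everything else in the integrand
is known given past, context and action. This reduces to `integral_weighted` for the function `h *
(1 - q)`. -/
lemma integral_weighted_mark (hrun : IsRun μ PW q φ F pmap δ W A Y fhat)
    (hq : Measurable q) (hq01 : ∀ x, 0 ≤ q x ∧ q x ≤ 1)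
    (hπ : HasPolicies pmap W A Y fhat) (hK : 0 < K) {t : ℕ} (ht : 1 ≤ t) (h0 : 0 < δ t)
    (h1 : δ t ≤ 1) {Z : Ω → ℝ} (hZ : Measurable[history W A Y (t - 1)] Z)
    {M : ℝ} (hZM : ∀ ω, |Z ω| ≤ M) {h : Fin K × Ctx d → ℝ} (hh : Measurable h) {M' : ℝ}
    (hM' : ∀ x, |h x| ≤ M') :
    ∫ ω, Z ω * ((K : ℝ)⁻¹ / design pmap δ fhat t ω (A t ω, W t ω) * h (A t ω, W t ω) *
        (1 - Y t ω)) ∂μ =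
      (∫ ω, Z ω ∂μ) * ∫ x, h x * (1 - q x) ∂(refLaw K PW) := by
  set g : Ω × (Fin K × Ctx d) → ℝ := fun x =>
    Z x.1 * ((K : ℝ)⁻¹ / design pmap δ fhat t x.1 x.2 * h x.2) with hgdef
  have hG : Measurable[(history W A Y (t - 1)).prod inferInstance] g :=
    (measurable_past_prod hZ).mul
      (((hπ.measurable_design t).const_div _).mul (measurable_snd_prod hh))
  have hgM : ∀ x, |g x| ≤ M * (1 / δ t * M') := fun x => by
    obtain ⟨g1, g2⟩ := abs_weighted_le hπ hK h0 h1 x.1 x.2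
    rw [hgdef, abs_mul, abs_mul, abs_of_nonneg g1]
    have hZ0 := (abs_nonneg _).trans (hZM x.1)
    exact mul_le_mul (hZM _) (mul_le_mul g2 (hM' _) (abs_nonneg _) (by positivity))
      (by positivity) hZ0
  have hGm : Measurable fun ω => g (ω, (A t ω, W t ω)) :=
    (hG.mono (sup_le_sup (MeasurableSpace.comap_mono (hrun.history_le (t - 1))) le_rfl)
      le_rfl).comp (measurable_id.prodMk
        ((hrun.measurable_action t).prodMk (hrun.measurable_context t)))
  have hGI : Integrable (fun ω => g (ω, (A t ω, W t ω))) μ :=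
    integrable_of_measurable_of_abs_le hGm fun ω => hgM _
  have hqm : Measurable fun ω => q (A t ω, W t ω) :=
    hq.comp ((hrun.measurable_action t).prodMk (hrun.measurable_context t))
  have i1 : Integrable (fun ω => g (ω, (A t ω, W t ω)) * Y t ω) μ :=
    hGI.mul_of_abs_le (hrun.measurable_reward t) (M := 1) fun ω => by
      have := hrun.reward_mem_Icc t ω
      rw [abs_of_nonneg this.1]; exact this.2
  have i2 : Integrable (fun ω => g (ω, (A t ω, W t ω)) * q (A t ω, W t ω)) μ :=
    hGI.mul_of_abs_le hqm (M := 1) fun ω => by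
      rw [abs_of_nonneg (hq01 _).1]; exact (hq01 _).2
  have e1 := hrun.integral_mul_reward ht hG hgM
  have hh1 : Measurable fun x => h x * (1 - q x) := hh.mul (hq.const_sub 1)
  rw [← hrun.integral_weighted hπ hK ht h0 h1 hZ hZM hh1 (M' := M') fun x => by
    obtain ⟨r1, r2⟩ := hq01 x
    rw [abs_mul, abs_of_nonneg (by linarith : 0 ≤ 1 - q x)]
    have := hM' x
    have := abs_nonneg (h x)
    nlinarith]
  calc _ = ∫ ω, (g (ω, (A t ω, W t ω)) - g (ω, (A t ω, W t ω)) * Y t ω) ∂μ :=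
        integral_congr_ae (Filter.Eventually.of_forall fun ω => by
          simp only [hgdef]; ring)
    _ = ∫ ω, (g (ω, (A t ω, W t ω)) - g (ω, (A t ω, W t ω)) * q (A t ω, W t ω)) ∂μ := by
        rw [integral_sub hGI i1, integral_sub hGI i2, e1]
    _ = _ := integral_congr_ae (Filter.Eventually.of_forall fun ω => by
          simp only [hgdef]; ring)

/-- The conditional mean of the reward given the past is the value of the design. -/
lemma integral_past_mul_reward (hrun : IsRun μ PW q φ F pmap δ W A Y fhat)
    (hq : Measurable q) (hq01 : ∀ x, 0 ≤ q x ∧ q x ≤ 1)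
    (hπ : HasPolicies pmap W A Y fhat) (hK : 0 < K) {t : ℕ} (ht : 1 ≤ t) (h0 : 0 < δ t)
    (h1 : δ t ≤ 1) {Z : Ω → ℝ} (hZ : Measurable[history W A Y (t - 1)] Z)
    {M : ℝ} (hZM : ∀ ω, |Z ω| ≤ M) :
    ∫ ω, Z ω * Y t ω ∂μ = ∫ ω, Z ω * value PW q (design pmap δ fhat t ω) ∂μ := by
  have e1 := hrun.integral_mul_reward ht (G := fun x => Z x.1) (measurable_past_prod hZ)
    (M := M) fun x => hZM _
  have e2 := hrun.integral_action hπ hK ht h0 h1 (G := fun x => Z x.1 * q x.2)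
    ((measurable_past_prod hZ).mul (measurable_snd_prod hq)) (M := M) fun x => by
      rw [abs_mul, abs_of_nonneg (hq01 _).1]
      have := hq01 x.2
      have := hZM x.1
      have := abs_nonneg (Z x.1)
      nlinarith
  refine (e1.trans e2).trans (integral_congr_ae (Filter.Eventually.of_forall fun ω => ?_))
  simp only
  rw [value, ← integral_const_mul]
  refine integral_congr_ae (Filter.Eventually.of_forall fun c => ?_)
  simp only
  rw [Finset.mul_sum]
  exact Finset.sum_congr rfl fun a _ => by ring

lemma measurable_value_design (hq : Measurable q) (hπ : HasPolicies pmap W A Y fhat) (t : ℕ) :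
    Measurable[history W A Y (t - 1)] fun ω => value PW q (design pmap δ fhat t ω) := by
  let := history W A Y (t - 1)
  have hd := hπ.measurable_design (δ := δ) t
  have : Measurable fun x : Ω × Ctx d => ∑ a, q (a, x.2) * design pmap δ fhat t x.1 (a, x.2) :=
    Finset.measurable_sum _ fun a _ =>
      (hq.comp (measurable_const.prodMk measurable_snd)).mul
        (hd.comp (measurable_fst.prodMk (measurable_const.prodMk measurable_snd)))
  exact this.stronglyMeasurable.integral_prod_right.measurable

/-- A run of the algorithm is an importance weighted sample from the reference law. -/
lemma isWeightedSample (hrun : IsRun μ PW q φ F pmap δ W A Y fhat)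
    (hq : Measurable q) (hq01 : ∀ x, 0 ≤ q x ∧ q x ≤ 1)
    (hπ : HasPolicies pmap W A Y fhat) (hK : 0 < K) {t : ℕ}
    (hδ : ∀ τ ∈ Finset.Icc 1 t, 0 < δ τ ∧ δ τ ≤ 1 ∧ δ t ≤ δ τ) (ht : 1 ≤ t) :
    IsWeightedSample μ (history W A Y) (refLaw K PW) (fun x => 1 - q x) t (1 / δ t)
      (fun τ ω => (K : ℝ)⁻¹ / design pmap δ fhat τ ω (A τ ω, W τ ω)) (fun τ ω => 1 - Y τ ω)
      (fun τ ω => (A τ ω, W τ ω)) where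
  le := hrun.history_le
  mono := history_mono
  measurable_weight τ hτ := by
    have h1 : 1 ≤ τ := (Finset.mem_Icc.1 hτ).1
    have := measurable_comp_past (history_mono (Nat.sub_le _ _))
      ((measurable_action_history h1).prodMk (measurable_context_history h1))
      (hπ.measurable_design (δ := δ) τ)
    exact this.const_div _
  measurable_mark τ hτ := (measurable_reward_history (Finset.mem_Icc.1 hτ).1).const_sub 1
  measurable_point τ hτ := (measurable_action_history (Finset.mem_Icc.1 hτ).1).prodMk
    (measurable_context_history (Finset.mem_Icc.1 hτ).1)
  measurable_density := hq.const_sub 1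
  density_mem x := ⟨by linarith [(hq01 x).2], by linarith [(hq01 x).1]⟩
  weight_mem τ hτ ω := by
    obtain ⟨h0, h1, h2⟩ := hδ τ hτ
    obtain ⟨g1, g2⟩ := abs_weighted_le hπ hK h0 h1 ω (A τ ω, W τ ω)
    have := (hδ t (Finset.mem_Icc.2 ⟨ht, le_rfl⟩)).1
    exact ⟨g1, g2.trans (one_div_le_one_div_of_le this h2)⟩
  mark_mem τ _ ω := by
    have := hrun.reward_mem_Icc τ ω
    constructor <;> linarith
  integral_weight τ hτ Z hZ hZM h hh hM := by
    obtain ⟨h0, h1, -⟩ := hδ τ hτ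
    obtain ⟨M, hZM⟩ := hZM
    obtain ⟨M', hM⟩ := hM
    exact hrun.integral_weighted hπ hK (Finset.mem_Icc.1 hτ).1 h0 h1 hZ hZM hh hM
  integral_weight_mark τ hτ Z hZ hZM h hh hM := by
    obtain ⟨h0, h1, -⟩ := hδ τ hτ
    obtain ⟨M, hZM⟩ := hZM
    obtain ⟨M', hM⟩ := hM
    exact hrun.integral_weighted_mark hq hq01 hπ hK (Finset.mem_Icc.1 hτ).1 h0 h1 hZ hZM hh hM

end IsRun


/-! ### The two variants -/

section Variants

set_option linter.unusedSectionVars false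

variable {K d : ℕ} {PW : Measure (Ctx d)} [IsProbabilityMeasure PW] {q : Fin K × Ctx d → ℝ}

lemma abs_hinge_sub_le (x y : ℝ) : |hinge x - hinge y| ≤ |x - y| := by
  unfold hinge
  refine (abs_max_sub_max_le_max _ _ _ _).trans (max_le (by simp) (le_of_eq ?_))
  congr 1; ring

lemma hinge_mono : Monotone hinge := fun _ _ h => max_le_max le_rfl (by linarith)

lemma hinge_nonneg (x : ℝ) : 0 ≤ hinge x := le_max_left _ _

lemma le_hinge (x : ℝ) : 1 + x ≤ hinge x := le_max_right _ _

lemma measurable_hinge : Measurable hinge := measurable_const.max (measurable_id.const_add 1)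

lemma measurable_of_sections {f : Regressor K d} (h : ∀ a, Measurable fun w => f (a, w)) :
    Measurable f :=
  measurable_from_prod_countable_right h

lemma measurable_section {f : Regressor K d} (hf : Measurable f) (a : Fin K) :
    Measurable fun w => f (a, w) :=
  hf.comp (measurable_const.prodMk measurable_id)

lemma stdSimplex_le_one {v : Fin K → ℝ} (hv : v ∈ stdSimplex ℝ (Fin K)) (a : Fin K) :
    v a ≤ 1 := by
  rw [← hv.2]
  exact Finset.single_le_sum (fun i _ => hv.1 i) (Finset.mem_univ a)

lemma sum_mul_mem {v c : Fin K → ℝ} (hv : v ∈ stdSimplex ℝ (Fin K))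
    (hc : ∀ a, 0 ≤ c a ∧ c a ≤ 1) : 0 ≤ ∑ a, c a * v a ∧ ∑ a, c a * v a ≤ 1 := by
  refine ⟨Finset.sum_nonneg fun a _ => mul_nonneg (hc a).1 (hv.1 a), ?_⟩
  rw [← hv.2]
  exact Finset.sum_le_sum fun a _ => mul_le_of_le_one_left (hv.1 a) (hc a).2

lemma integrable_value (hq : Measurable q) (hq01 : ∀ x, 0 ≤ q x ∧ q x ≤ 1) {π : Regressor K d}
    (hπ : π ∈ measurablePolicies K d) : Integrable (fun w => ∑ a, q (a, w) * π (a, w)) PW :=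
  integrable_of_measurable_of_abs_le (Finset.measurable_sum _ fun a _ =>
    (measurable_section hq a).mul (measurable_section hπ.1 a)) (M := 1) fun w => by
      have := sum_mul_mem (hπ.2 w) (fun a => hq01 (a, w))
      rw [abs_of_nonneg this.1]; exact this.2

lemma value_nonneg (hq01 : ∀ x, 0 ≤ q x ∧ q x ≤ 1) {π : Regressor K d}
    (hπ : π ∈ measurablePolicies K d) : 0 ≤ value PW q π :=
  integral_nonneg fun w => (sum_mul_mem (hπ.2 w) (fun a => hq01 (a, w))).1

lemma value_le_one (hq : Measurable q) (hq01 : ∀ x, 0 ≤ q x ∧ q x ≤ 1) {π : Regressor K d}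
    (hπ : π ∈ measurablePolicies K d) : value PW q π ≤ 1 := by
  refine (integral_mono (integrable_value hq hq01 hπ) (integrable_const 1) fun w =>
    (sum_mul_mem (hπ.2 w) (fun a => hq01 (a, w))).2).trans ?_
  simp

lemma classId_subset {F₀ : Set (Ctx d → ℝ)} (hF₀ : ∀ h ∈ F₀, Measurable h) :
    classId K F₀ ⊆ measurablePolicies K d := fun _ hf =>
  ⟨measurable_of_sections fun a => hF₀ _ (hf.1 a), hf.2⟩

lemma argmaxPolicy_simplex (s : (Fin K → ℝ) → Fin K) (f : Regressor K d) (w : Ctx d) :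
    (fun a => argmaxPolicy s f (a, w)) ∈ stdSimplex ℝ (Fin K) := by
  refine ⟨fun a => ?_, ?_⟩
  · simp only [argmaxPolicy]; split_ifs <;> norm_num
  · simp [argmaxPolicy]

lemma measurable_argmaxPolicy_comp {Ω : Type*} [MeasurableSpace Ω] {s : (Fin K → ℝ) → Fin K}
    (hs : Measurable s) {f : Ω → Regressor K d}
    (hf : Measurable fun x : Ω × (Fin K × Ctx d) => f x.1 x.2) :
    Measurable fun x : Ω × (Fin K × Ctx d) => argmaxPolicy s (f x.1) x.2 := by
  have h : Measurable fun x : Ω × (Fin K × Ctx d) => s fun a => f x.1 (a, x.2.2) :=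
    hs.comp (measurable_pi_lambda _ fun a =>
      hf.comp (measurable_fst.prodMk
        (measurable_const.prodMk (measurable_snd.comp measurable_snd))))
  exact Measurable.ite (measurableSet_eq_fun (measurable_fst.comp measurable_snd) h)
    measurable_const measurable_const

lemma argmaxPolicy_mem {s : (Fin K → ℝ) → Fin K} (hs : Measurable s) {f : Regressor K d}
    (hf : Measurable f) : argmaxPolicy s f ∈ measurablePolicies K d := by
  refine ⟨?_, argmaxPolicy_simplex s f⟩
  exact (measurable_argmaxPolicy_comp (Ω := Unit) hs (f := fun _ => f)
    (hf.comp measurable_snd)).comp (measurable_const (a := ()) |>.prodMk measurable_id)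

/-- Calibration of the hinge loss at a point: `i` maximizes `f` and `j` maximizes `q`. -/
lemma hinge_calibration (hK : 0 < K) {f c π : Fin K → ℝ} {i j : Fin K} (hf0 : ∑ a, f a = 0)
    (hi : ∀ a, f a ≤ f i) (hj : ∀ a, c a ≤ c j) (hc1 : ∀ a, c a ≤ 1)
    (hπ : π ∈ stdSimplex ℝ (Fin K)) :
    K * (1 - c j) + (∑ a, c a * π a - c i) ≤ ∑ a, min (hinge (f a)) K * (1 - c a) := by
  have hK0 : (0 : ℝ) < K := by exact_mod_cast hK
  have hv0 : ∀ a, 0 ≤ min (hinge (f a)) (K : ℝ) := fun a => le_min (hinge_nonneg _) hK0.le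
  have hfi : 0 ≤ f i := by
    have h1 : ∑ a, f a ≤ ∑ _a : Fin K, f i := Finset.sum_le_sum fun a _ => hi a
    rw [hf0, Finset.sum_const, Finset.card_univ, Fintype.card_fin, nsmul_eq_mul] at h1
    exact nonneg_of_mul_nonneg_right h1 hK0
  have hvi : 1 ≤ min (hinge (f i)) (K : ℝ) :=
    le_min (by linarith [le_hinge (f i)]) (by exact_mod_cast hK)
  -- Clipping the hinge at `K` preserves the constraint that drives calibration: either one
  -- coordinate already reaches `K`, or nothing is clipped and `∑ (1 + f a) = K`.
  have hsum : (K : ℝ) ≤ ∑ a, min (hinge (f a)) (K : ℝ) := by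
    by_cases h : ∃ a, (K : ℝ) ≤ hinge (f a)
    · obtain ⟨a, ha⟩ := h
      calc (K : ℝ) = min (hinge (f a)) K := (min_eq_right ha).symm
        _ ≤ _ := Finset.single_le_sum (f := fun a => min (hinge (f a)) (K : ℝ))
          (fun a _ => hv0 a) (Finset.mem_univ a)
    · push Not at h
      calc (K : ℝ) = ∑ a, (1 + f a) := by rw [Finset.sum_add_distrib, hf0]; simp
        _ ≤ _ := Finset.sum_le_sum fun a _ => le_min (le_hinge _) ((le_hinge _).trans (h a).le)
  have hπj : ∑ a, c a * π a ≤ c j := by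
    calc ∑ a, c a * π a ≤ ∑ a, c j * π a :=
          Finset.sum_le_sum fun a _ => mul_le_mul_of_nonneg_right (hj a) (hπ.1 a)
      _ = c j := by rw [← Finset.mul_sum, hπ.2, mul_one]
  -- The total weight times the least loss `1 - c j`, plus the weighted gaps. The chosen action `i`
  -- has weight at least 1 because the maximum of a vector of sum zero is nonnegative, so its gap is
  -- counted in full.
  have hdecomp : ∑ a, min (hinge (f a)) K * (1 - c a) =
      (∑ a, min (hinge (f a)) (K : ℝ)) * (1 - c j) +
        ∑ a, min (hinge (f a)) (K : ℝ) * (c j - c a) := by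
    rw [Finset.sum_mul, ← Finset.sum_add_distrib]
    exact Finset.sum_congr rfl fun a _ => by ring
  have h1 : min (hinge (f i)) (K : ℝ) * (c j - c i) ≤
      ∑ a, min (hinge (f a)) (K : ℝ) * (c j - c a) :=
    Finset.single_le_sum (f := fun a => min (hinge (f a)) (K : ℝ) * (c j - c a))
      (fun a _ => mul_nonneg (hv0 a) (sub_nonneg.2 (hj a))) (Finset.mem_univ i)
  have h2 : c j - c i ≤ min (hinge (f i)) (K : ℝ) * (c j - c i) :=
    le_mul_of_one_le_left (sub_nonneg.2 (hj i)) hvi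
  have h3 := mul_le_mul_of_nonneg_right hsum (sub_nonneg.2 (hc1 j))
  rw [hdecomp]
  linarith

/-- The regressor that minimizes the hinge-risk. -/
noncomputable def bayesRegressor (s : (Fin K → ℝ) → Fin K) (q : Fin K × Ctx d → ℝ) : Regressor K d :=
  fun x => K * argmaxPolicy s q x - 1

lemma hinge_bayesRegressor (hK : 0 < K) (s : (Fin K → ℝ) → Fin K) (q : Fin K × Ctx d → ℝ)
    (x : Fin K × Ctx d) : hinge (bayesRegressor s q x) = K * argmaxPolicy s q x := by
  have h : 0 ≤ argmaxPolicy s q x := (argmaxPolicy_simplex s q x.2).1 x.1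
  rw [hinge, bayesRegressor, add_sub_cancel, max_eq_right (by positivity)]

lemma sum_bayesRegressor (s : (Fin K → ℝ) → Fin K) (q : Fin K × Ctx d → ℝ) (w : Ctx d) :
    ∑ a, bayesRegressor s q (a, w) = 0 := by
  simp only [bayesRegressor, Finset.sum_sub_distrib, ← Finset.mul_sum]
  rw [(argmaxPolicy_simplex s q w).2]
  simp

lemma hingeRisk_eq (f : Regressor K d) :
    hingeRisk PW q f = ∫⁻ x, ENNReal.ofReal (hinge (f x) * (1 - q x)) ∂(refLaw K PW) := by
  unfold hingeRisk loss
  congr 1 with x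
  congr 1
  ring

/-- The hinge-risk is extended-valued, so comparison with a regressor of finite risk has to give
integrability before it gives an inequality between real integrals. -/
lemma integral_hinge_le (hq : Measurable q) (hq01 : ∀ x, 0 ≤ q x ∧ q x ≤ 1)
    {f g : Regressor K d} (hf : Measurable f) (hg : Integrable
      (fun x => hinge (g x) * (1 - q x)) (refLaw K PW))
    (h : hingeRisk PW q f ≤ hingeRisk PW q g) :
    Integrable (fun x => hinge (f x) * (1 - q x)) (refLaw K PW) ∧
      ∫ x, hinge (f x) * (1 - q x) ∂(refLaw K PW) ≤
        ∫ x, hinge (g x) * (1 - q x) ∂(refLaw K PW) := by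
  have hpos : ∀ (g : Regressor K d) x, 0 ≤ hinge (g x) * (1 - q x) := fun g x =>
    mul_nonneg (hinge_nonneg _) (by linarith [(hq01 x).2])
  rw [hingeRisk_eq, hingeRisk_eq,
    ← ofReal_integral_eq_lintegral_ofReal hg (Filter.Eventually.of_forall (hpos g))] at h
  have hfm : Measurable fun x => hinge (f x) * (1 - q x) :=
    (measurable_hinge.comp hf).mul (hq.const_sub 1)
  have hfI : Integrable (fun x => hinge (f x) * (1 - q x)) (refLaw K PW) := by
    refine ⟨hfm.aestronglyMeasurable, ?_⟩
    rw [hasFiniteIntegral_iff_ofReal (Filter.Eventually.of_forall (hpos f))]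
    exact h.trans_lt ENNReal.ofReal_lt_top
  rw [← ofReal_integral_eq_lintegral_ofReal hfI (Filter.Eventually.of_forall (hpos f))] at h
  exact ⟨hfI, (ENNReal.ofReal_le_ofReal_iff (integral_nonneg (hpos g))).1 h⟩

/-- Pointwise calibration is integrated and compared with the Bayes regressor, whose risk is at
least that of `fstar`. The hinge of `f` is clipped at `K` in between: this only lowers the risk and
makes the integrand bounded, as `integral_refLaw` requires. -/
lemma value_sub_le_of_hinge (hK : 0 < K) (hq : Measurable q) (hq01 : ∀ x, 0 ≤ q x ∧ q x ≤ 1)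
    {s : (Fin K → ℝ) → Fin K} (hs : IsArgmaxRule s) {fstar : Regressor K d}
    (hfsm : Measurable fstar) (hmin : ∀ f : Regressor K d, Measurable f →
      (∀ w, ∑ a, f (a, w) = 0) → hingeRisk PW q fstar ≤ hingeRisk PW q f)
    {f : Regressor K d} (hf : Measurable f) (hf0 : ∀ w, ∑ a, f (a, w) = 0) {B : ℝ}
    (hB : ∀ x, |hinge (f x) - hinge (fstar x)| ≤ B) {π : Regressor K d}
    (hπ : π ∈ measurablePolicies K d) :
    value PW q π - value PW q (argmaxPolicy s f) ≤
      K * ∫ x, (hinge (f x) - hinge (fstar x)) * (1 - q x) ∂(refLaw K PW) := by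
  have := isProbabilityMeasure_refLaw hK PW
  have hK0 : (0 : ℝ) < K := by exact_mod_cast hK
  have hqm : Measurable fun x => 1 - q x := hq.const_sub 1
  have hq1 : ∀ x, |1 - q x| ≤ 1 := fun x => by
    rw [abs_le]; constructor <;> linarith [(hq01 x).1, (hq01 x).2]
  have hb := argmaxPolicy_mem (d := d) hs.measurable hq
  have hbm : Measurable (bayesRegressor s q) := (hb.1.const_mul _).sub_const 1
  have hbM : ∀ x, |hinge (bayesRegressor s q x) * (1 - q x)| ≤ K * 1 := fun x => by
    rw [abs_mul, hinge_bayesRegressor hK, abs_mul, abs_of_pos hK0,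
      abs_of_nonneg ((hb.2 x.2).1 x.1)]
    have h1 : argmaxPolicy s q x ≤ 1 := stdSimplex_le_one (hb.2 x.2) x.1
    have h2 := (hb.2 x.2).1 x.1
    calc K * argmaxPolicy s q x * |1 - q x| ≤ K * 1 * 1 := by
          gcongr
          exact hq1 x
      _ = _ := by ring
  have hbm' : Measurable fun x => hinge (bayesRegressor s q x) * (1 - q x) :=
    (measurable_hinge.comp hbm).mul hqm
  have hbI := integrable_of_measurable_of_abs_le (μ := refLaw K PW) hbm' hbM
  obtain ⟨hsI, hsle⟩ := integral_hinge_le hq hq01 hfsm hbI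
    (hmin _ hbm (sum_bayesRegressor s q))
  have hψI : Integrable (fun x => (hinge (f x) - hinge (fstar x)) * (1 - q x)) (refLaw K PW) :=
    (integrable_of_measurable_of_abs_le
      ((measurable_hinge.comp hf).sub (measurable_hinge.comp hfsm)) hB).mul_of_abs_le hqm hq1
  have hvm : Measurable fun x => min (hinge (f x)) K * (1 - q x) :=
    ((measurable_hinge.comp hf).min measurable_const).mul hqm
  have hvM : ∀ x, |min (hinge (f x)) K * (1 - q x)| ≤ K * 1 := fun x => by
    rw [abs_mul, abs_of_nonneg (le_min (hinge_nonneg _) hK0.le)]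
    exact mul_le_mul (min_le_right _ _) (hq1 x) (abs_nonneg _) hK0.le
  have h1 : ∫ x, min (hinge (f x)) K * (1 - q x) ∂(refLaw K PW) ≤
      ∫ x, (hinge (f x) - hinge (fstar x)) * (1 - q x) ∂(refLaw K PW) +
        ∫ x, hinge (fstar x) * (1 - q x) ∂(refLaw K PW) := by
    rw [← integral_add hψI hsI]
    refine integral_mono (integrable_of_measurable_of_abs_le hvm hvM) (hψI.add hsI) fun x => ?_
    have h := mul_le_mul_of_nonneg_right (min_le_left (hinge (f x)) (K : ℝ))
      (by linarith [(hq01 x).2] : 0 ≤ 1 - q x)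
    simp only
    linarith
  have h2 : ∫ x, hinge (bayesRegressor s q x) * (1 - q x) ∂(refLaw K PW) +
      (K : ℝ)⁻¹ * (value PW q π - value PW q (argmaxPolicy s f)) ≤
        ∫ x, min (hinge (f x)) K * (1 - q x) ∂(refLaw K PW) := by
    have hfp := argmaxPolicy_mem (d := d) hs.measurable hf
    rw [integral_refLaw hK PW hbm' hbM, integral_refLaw hK PW hvm hvM, value, value,
      ← integral_sub (integrable_value hq hq01 hπ) (integrable_value hq hq01 hfp),
      ← integral_const_mul]
    have sI : ∀ {h : Fin K × Ctx d → ℝ} {M : ℝ}, Measurable h → (∀ x, |h x| ≤ M) →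
        Integrable (fun w => ∑ a, (K : ℝ)⁻¹ * h (a, w)) PW := fun hh hM =>
      integrable_finsetSum _ fun a _ => (integrable_of_measurable_of_abs_le
        (measurable_section hh a) fun w => hM _).const_mul _
    have dI : Integrable (fun w => (K : ℝ)⁻¹ * (∑ a, q (a, w) * π (a, w) -
        ∑ a, q (a, w) * argmaxPolicy s f (a, w))) PW :=
      ((integrable_value hq hq01 hπ).sub (integrable_value hq hq01 hfp)).const_mul _
    rw [← integral_add (sI hbm' hbM) dI]
    refine integral_mono ((sI hbm' hbM).add dI) (sI hvm hvM) fun w => ?_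
    simp only [← Finset.mul_sum]
    rw [← mul_add]
    refine mul_le_mul_of_nonneg_left ?_ (by positivity)
    have h3 := hinge_calibration hK (hf0 w) (hs.le_apply fun a => f (a, w))
      (hs.le_apply fun a => q (a, w)) (fun a => (hq01 (a, w)).2) (hπ.2 w)
    refine le_trans (le_of_eq ?_) h3
    simp [hinge_bayesRegressor hK, argmaxPolicy]
  have h3 : (K : ℝ)⁻¹ * (value PW q π - value PW q (argmaxPolicy s f)) ≤
      ∫ x, (hinge (f x) - hinge (fstar x)) * (1 - q x) ∂(refLaw K PW) := by linarith
  rwa [inv_mul_le_iff₀ hK0] at h3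

/-- The constant part of `1 - q` drops out because `f` and `g` have the same sum over the actions;
the factor `K` undoes the uniform weight. -/
lemma integral_direct_eq (hK : 0 < K) (hq : Measurable q) (hq01 : ∀ x, 0 ≤ q x ∧ q x ≤ 1)
    {f g : Regressor K d} (hf : f ∈ measurablePolicies K d) (hg : g ∈ measurablePolicies K d) :
    K * ∫ x, (f x - g x) * (1 - q x) ∂(refLaw K PW) = value PW q g - value PW q f := by
  have hK0 : (K : ℝ) ≠ 0 := by positivity
  have hm : Measurable fun x => (f x - g x) * (1 - q x) := (hf.1.sub hg.1).mul (hq.const_sub 1)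
  have hM : ∀ x, |(f x - g x) * (1 - q x)| ≤ 1 * 1 := fun x => by
    have h1 := (hf.2 x.2).1 x.1
    have h2 := (hg.2 x.2).1 x.1
    have h3 := stdSimplex_le_one (hf.2 x.2) x.1
    have h4 := stdSimplex_le_one (hg.2 x.2) x.1
    simp only [Prod.mk.eta] at h1 h2 h3 h4
    rw [abs_mul]
    refine mul_le_mul (abs_le.2 ⟨by linarith, by linarith⟩)
      (abs_le.2 ⟨by linarith [(hq01 x).2], by linarith [(hq01 x).1]⟩) (abs_nonneg _) zero_le_one
  rw [integral_refLaw hK PW hm hM, value, value,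
    ← integral_sub (integrable_value hq hq01 hg) (integrable_value hq hq01 hf),
    ← integral_const_mul]
  refine integral_congr_ae (Filter.Eventually.of_forall fun w => ?_)
  simp only
  rw [← Finset.mul_sum, mul_inv_cancel_left₀ hK0, ← Finset.sum_sub_distrib]
  have h5 : ∑ a, (f (a, w) - g (a, w)) = 0 := by
    rw [Finset.sum_sub_distrib, (hf.2 w).2, (hg.2 w).2, sub_self]
  calc ∑ a, (f (a, w) - g (a, w)) * (1 - q (a, w))
      = ∑ a, (f (a, w) - g (a, w)) +
          ∑ a, (q (a, w) * g (a, w) - q (a, w) * f (a, w)) := by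
        rw [← Finset.sum_add_distrib]
        exact Finset.sum_congr rfl fun a _ => by ring
    _ = _ := by rw [h5, zero_add]

variable {B : ℝ} {F₀ : Set (Ctx d → ℝ)} {φ : ℝ → ℝ} {F : Set (Regressor K d)}
  {pmap : Regressor K d → Regressor K d} {Comp : Set (Regressor K d)}

lemma measurable_of_mem_class (hF₀ : ∀ h ∈ F₀, Measurable h)
    (hvar : IsDirectVariant F₀ φ F pmap Comp ∨ IsHingeVariant PW q B F₀ φ F pmap Comp)
    {f : Regressor K d} (hf : f ∈ F) : Measurable f := by
  rcases hvar with ⟨-, rfl, -⟩ | ⟨-, rfl, -⟩ <;>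
  exact measurable_of_sections fun a => hF₀ _ (hf.1 a)

lemma comparator_subset (hF₀ : ∀ h ∈ F₀, Measurable h)
    (hvar : IsDirectVariant F₀ φ F pmap Comp ∨ IsHingeVariant PW q B F₀ φ F pmap Comp) :
    Comp ⊆ measurablePolicies K d := by
  rcases hvar with ⟨-, -, -, rfl⟩ | ⟨-, -, -, rfl, -⟩
  · exact classId_subset hF₀
  · exact le_rfl

lemma policy_mem (hF₀ : ∀ h ∈ F₀, Measurable h)
    (hvar : IsDirectVariant F₀ φ F pmap Comp ∨ IsHingeVariant PW q B F₀ φ F pmap Comp)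
    {f : Regressor K d} (hf : f ∈ F) : pmap f ∈ measurablePolicies K d := by
  have hm := measurable_of_mem_class hF₀ hvar hf
  rcases hvar with ⟨-, rfl, rfl, -⟩ | ⟨-, rfl, ⟨s, hs, rfl⟩, -⟩
  · exact classId_subset hF₀ hf
  · exact argmaxPolicy_mem hs.measurable hm

lemma abs_loss_sub_le
    (hvar : IsDirectVariant F₀ φ F pmap Comp ∨ IsHingeVariant PW q B F₀ φ F pmap Comp)
    (x y : ℝ) : |φ x - φ y| ≤ |x - y| := by
  rcases hvar with ⟨rfl, -⟩ | ⟨rfl, -⟩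
  · exact le_rfl
  · exact abs_hinge_sub_le x y

lemma loss_mono
    (hvar : IsDirectVariant F₀ φ F pmap Comp ∨ IsHingeVariant PW q B F₀ φ F pmap Comp) :
    Monotone φ := by
  rcases hvar with ⟨rfl, -⟩ | ⟨rfl, -⟩
  · exact monotone_id
  · exact hinge_mono

lemma hasPolicies_of_variant {Ω : Type*} [MeasurableSpace Ω] {μ : Measure Ω} {δ : ℕ → ℝ}
    {W : ℕ → Ω → Ctx d} {A : ℕ → Ω → Fin K} {Y : ℕ → Ω → ℝ} {fhat : ℕ → Ω → Regressor K d}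
    (hF₀ : ∀ h ∈ F₀, Measurable h)
    (hvar : IsDirectVariant F₀ φ F pmap Comp ∨ IsHingeVariant PW q B F₀ φ F pmap Comp)
    (hrun : IsRun μ PW q φ F pmap δ W A Y fhat) : HasPolicies pmap W A Y fhat where
  measurable t ht := by
    have h := hrun.fhat_adapted t ht
    rcases hvar with ⟨-, -, rfl, -⟩ | ⟨-, -, ⟨s, hs, rfl⟩, -⟩
    · exact h
    · exact @measurable_argmaxPolicy_comp K d Ω (history W A Y t) s hs.measurable _ h
  mem_stdSimplex t ht ω := (policy_mem hF₀ hvar (hrun.fhat_mem t ht ω)).2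

/-- A regressor in the class whose excess risk controls the regret of the policies. -/
lemma exists_comparator (hK : 0 < K) (hB : 0 < B) (hq : Measurable q)
    (hq01 : ∀ x, 0 ≤ q x ∧ q x ≤ 1) (hF₀ : ∀ h ∈ F₀, Measurable h) (hF : F.Nonempty)
    (hvar : IsDirectVariant F₀ φ F pmap Comp ∨ IsHingeVariant PW q B F₀ φ F pmap Comp) {κ : ℝ}
    (hκ : 0 < κ) :
    ∃ fstar ∈ F, (∀ f ∈ F, ∀ x, |φ (f x) - φ (fstar x)| ≤ B + 1) ∧
      ∀ f ∈ F, ∀ π ∈ Comp, value PW q π - value PW q (pmap f) ≤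
        K * ∫ x, (φ (f x) - φ (fstar x)) * (1 - q x) ∂(refLaw K PW) + κ := by
  have hFm := fun f hf => measurable_of_mem_class hF₀ hvar (f := f) hf
  rcases hvar with ⟨rfl, rfl, rfl, rfl⟩ | ⟨rfl, rfl, ⟨s, hs, rfl⟩, rfl, ⟨fstar, hfs, hfsm, -, hmin⟩, hosc⟩
  · have hsub := classId_subset (K := K) hF₀
    have hbdd : BddAbove (value PW q '' classId K F₀) :=
      ⟨1, by rintro _ ⟨π, hπ, rfl⟩; exact value_le_one hq hq01 (hsub hπ)⟩
    -- The supremum of the values over the class need not be attained, hence the slack `κ`. Two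
    -- simplex-valued functions differ by at most 1, so `B + 1` bounds the oscillation in both
    -- variants.
    obtain ⟨_, ⟨fstar, hfs, rfl⟩, hlt⟩ :=
      exists_lt_of_lt_csSup (hF.image (value PW q)) (sub_lt_self (sSup _) hκ)
    refine ⟨fstar, hfs, fun f hf x => ?_, fun f hf π hπ => ?_⟩
    · have h1 := (hf.2 x.2).1 x.1
      have h2 := (hfs.2 x.2).1 x.1
      have h3 := stdSimplex_le_one (hf.2 x.2) x.1
      have h4 := stdSimplex_le_one (hfs.2 x.2) x.1
      simp only [Prod.mk.eta] at h1 h2 h3 h4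
      simp only [id_eq]
      rw [abs_le]
      constructor <;> linarith
    · have h1 := integral_direct_eq (PW := PW) hK hq hq01 (hsub hf) (hsub hfs)
      have h2 := le_csSup hbdd (Set.mem_image_of_mem _ hπ)
      simp only [id_eq]
      rw [h1]
      linarith
  · refine ⟨fstar, hfs, fun f hf x => (hosc f hf fstar hfs x).trans (by linarith),
      fun f hf π hπ => ?_⟩
    exact (value_sub_le_of_hinge hK hq hq01 hs hfsm hmin (hFm f hf) hf.2
      (fun x => hosc f hf fstar hfs x) hπ).trans (by linarith)

end Variants

/-! ### Brackets for the losses -/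

/-- A finite infimum over natural numbers is attained, so the bracketing number is itself the size
of a cover. -/
lemma coveredByBrackets_toNat {X : Type*} [MeasurableSpace X] {η : ℝ} {F : Set (X → ℝ)}
    {r : ENNReal} {P : Measure X} (h : bracketingNumber η F r P ≠ ⊤) :
    CoveredByBrackets η F r P (bracketingNumber η F r P).toNat := by
  classical
  have hne : ∃ n, CoveredByBrackets η F r P n := by
    by_contra hcon
    push Not at hcon
    exact h (by simp [bracketingNumber, hcon])
  have heq : bracketingNumber η F r P = (Nat.find hne : ℕ∞) := by
    refine le_antisymm (iInf₂_le _ (Nat.find_spec hne)) (le_iInf₂ fun n hn => ?_)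
    exact_mod_cast Nat.find_min' hne hn
  rw [heq, ENat.toNat_natCast]
  exact Nat.find_spec hne

lemma integral_sq_le_of_eLpNorm_le {X : Type*} [MeasurableSpace X] {P : Measure X} {f : X → ℝ}
    (hf : Measurable f) {η : ℝ} (hη : 0 ≤ η) (h : eLpNorm f 2 P ≤ ENNReal.ofReal η) :
    Integrable (fun x => f x ^ 2) P ∧ ∫ x, f x ^ 2 ∂P ≤ η ^ 2 := by
  have hL : MemLp f 2 P := ⟨hf.aestronglyMeasurable, h.trans_lt ENNReal.ofReal_lt_top⟩
  refine ⟨hL.integrable_sq, ?_⟩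
  rw [hL.eLpNorm_eq_integral_rpow_norm (by norm_num) (by norm_num),
    ENNReal.ofReal_le_ofReal_iff hη] at h
  simp only [ENNReal.toReal_ofNat, Real.rpow_ofNat, Real.norm_eq_abs, sq_abs] at h
  have h0 : 0 ≤ ∫ x, f x ^ 2 ∂P := integral_nonneg fun x => sq_nonneg _
  calc ∫ x, f x ^ 2 ∂P = ((∫ x, f x ^ 2 ∂P) ^ (2⁻¹ : ℝ)) ^ 2 := by
        rw [← Real.rpow_natCast, ← Real.rpow_mul h0]; norm_num
    _ ≤ η ^ 2 := pow_le_pow_left₀ (by positivity) h 2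

/-- A monotone 1-Lipschitz `φ` maps brackets to brackets that are no wider, and subtracting a fixed
function changes no width. Hence the loss class inherits the entropy of `F`, at the scales `2⁻ʲ`. -/
lemma exists_isBracketing {X : Type*} [MeasurableSpace X] {P : Measure X} {F : Set (X → ℝ)}
    {c₀ p : ℝ} (hent : EntropyBound F P c₀ p) {φ : ℝ → ℝ} (hφ : Monotone φ)
    (hφ1 : ∀ x y, |φ x - φ y| ≤ |x - y|) {g : X → ℝ} (hg : Measurable g) :
    ∃ (N : ℕ → ℕ) (l u : ∀ j, Fin (N j) → X → ℝ),
      IsBracketing P ((fun f x => φ (f x) - g x) '' F) N l u ∧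
        ∀ j, (N j : ℝ) ≤ Real.exp (c₀ * ((2 : ℝ) ^ p) ^ j) := by
  have hη : ∀ j : ℕ, (0 : ℝ) < (1 / 2) ^ j := fun j => by positivity
  have hη1 : ∀ j : ℕ, (1 / 2 : ℝ) ^ j ≤ 1 := fun j => pow_le_one₀ (by norm_num) (by norm_num)
  have hφm : Measurable φ := hφ.measurable
  choose l u hlu hcov using fun j => coveredByBrackets_toNat (hent _ (hη j) (hη1 j)).1
  refine ⟨fun j => (bracketingNumber ((1 / 2) ^ j) F 2 P).toNat,
    fun j i x => φ (l j i x) - g x, fun j i x => φ (u j i x) - g x, ?_, fun j => ?_⟩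
  · have hle : ∀ j i x, ((φ (u j i x) - g x) - (φ (l j i x) - g x)) ^ 2 ≤
        (u j i x - l j i x) ^ 2 := fun j i x => by
      rw [sub_sub_sub_cancel_right]
      exact sq_le_sq.2 (hφ1 _ _)
    have hm : ∀ j i, Measurable fun x => (φ (u j i x) - g x) - (φ (l j i x) - g x) :=
      fun j i => ((hφm.comp (hlu j i).2.1).sub hg).sub ((hφm.comp (hlu j i).1).sub hg)
    have hsq : ∀ j i, Integrable (fun x => (u j i x - l j i x) ^ 2) P ∧
        ∫ x, (u j i x - l j i x) ^ 2 ∂P ≤ ((1 / 2) ^ j) ^ 2 := fun j i =>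
      integral_sq_le_of_eLpNorm_le ((hlu j i).2.1.sub (hlu j i).1) (hη j).le (hlu j i).2.2
    refine ⟨fun j i => (hφm.comp (hlu j i).1).sub hg, fun j i => (hφm.comp (hlu j i).2.1).sub hg,
      fun j i => ?_, fun j i => ?_, ?_⟩
    · refine (hsq j i).1.mono' ((hm j i).pow_const 2).aestronglyMeasurable
        (Filter.Eventually.of_forall fun x => ?_)
      rw [Real.norm_eq_abs, abs_of_nonneg (sq_nonneg _)]
      exact hle j i x
    · exact (integral_mono_of_nonneg (Filter.Eventually.of_forall fun x => sq_nonneg _)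
        (hsq j i).1 (Filter.Eventually.of_forall (hle j i))).trans (hsq j i).2
    · rintro j _ ⟨f, hf, rfl⟩
      obtain ⟨i, hi⟩ := hcov j f hf
      exact ⟨i, fun x => ⟨sub_le_sub_right (hφ (hi x).1) _, sub_le_sub_right (hφ (hi x).2) _⟩⟩
  · have h := (hent _ (hη j) (hη1 j)).2
    have e : ((1 / 2 : ℝ) ^ j) ^ (-p) = ((2 : ℝ) ^ p) ^ j := by
      rw [one_div, inv_pow, Real.inv_rpow (by positivity), Real.rpow_neg (by positivity),
        inv_inv, ← Real.rpow_natCast, ← Real.rpow_natCast, ← Real.rpow_mul two_pos.le,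
        ← Real.rpow_mul two_pos.le, mul_comm]
    rw [e, Real.log_le_iff_le_exp (by positivity)] at h
    simp only
    linarith


/-! ### Regret bounds -/

/-- Disposes of the levels `x ≥ t * δ_t`, at which the Bernstein-type tail is unavailable: there the
target bound `δ_t * √x` is at least 1 and exceeds any regret of a single policy. -/
lemma sqrt_mul_rate_ge_one {p x : ℝ} {t : ℕ} (ht : 1 ≤ t) (h : t * rate p t ≤ x) :
    1 ≤ rate p t * Real.sqrt x := by
  have hd := rate_pos (p := p) ht
  calc (1 : ℝ) ≤ Real.sqrt (t * rate p t ^ 3) :=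
        Real.one_le_sqrt.2 (one_le_mul_rate_pow_three ht)
    _ ≤ Real.sqrt (rate p t ^ 2 * x) := by
        refine Real.sqrt_le_sqrt ?_
        have := mul_le_mul_of_nonneg_left h (sq_nonneg (rate p t))
        linarith
    _ = rate p t * Real.sqrt x := by rw [Real.sqrt_mul (sq_nonneg _), Real.sqrt_sq hd.le]

lemma rate_le_two_mul_rate_succ {p : ℝ} (hp : 0 < p) {t : ℕ} (ht : 1 ≤ t) :
    rate p t ≤ 2 * rate p (t + 1) := by
  have ht0 : (0 : ℝ) < t := by exact_mod_cast ht
  have ht1 : (1 : ℝ) ≤ t := by exact_mod_cast ht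
  set a := min (1 / 3 : ℝ) (1 / (p + 1)) with ha
  have ha0 : 0 < a := min_exponent_pos hp
  have ha1 : a ≤ 1 := (min_le_left _ _).trans (by norm_num)
  have h1 : (2 * (t : ℝ)) ^ (-a) ≤ ((t + 1 : ℕ) : ℝ) ^ (-a) :=
    Real.rpow_le_rpow_of_nonpos (by positivity) (by push_cast; linarith) (by linarith)
  have h2 : (2 : ℝ)⁻¹ ≤ (2 : ℝ) ^ (-a) := by
    rw [← Real.rpow_neg_one]
    exact Real.rpow_le_rpow_of_exponent_le one_le_two (by linarith)
  rw [Real.mul_rpow two_pos.le ht0.le] at h1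
  have h3 : (0 : ℝ) < (t : ℝ) ^ (-a) := Real.rpow_pos_of_pos ht0 _
  unfold rate
  rw [← ha]
  nlinarith

section Regret

set_option linter.unusedSectionVars false

variable {Ω : Type*} [m : MeasurableSpace Ω] {μ : Measure Ω} [IsProbabilityMeasure μ] {K d : ℕ}
  {PW : Measure (Ctx d)} [IsProbabilityMeasure PW] {q : Fin K × Ctx d → ℝ} {φ : ℝ → ℝ}
  {F : Set (Regressor K d)} {pmap : Regressor K d → Regressor K d}
  {W : ℕ → Ω → Ctx d} {A : ℕ → Ω → Fin K} {Y : ℕ → Ω → ℝ} {fhat : ℕ → Ω → Regressor K d}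

lemma design_mem_policies {δ : ℕ → ℝ} (hK : 0 < K) {t : ℕ} {ω : Ω} (h0 : 0 < δ t)
    (h1 : δ t ≤ 1) (hcur : currentPolicy pmap fhat (t - 1) ω ∈ measurablePolicies K d)
    (hπ : HasPolicies pmap W A Y fhat) :
    design pmap δ fhat t ω ∈ measurablePolicies K d :=
  ⟨(hcur.1.const_mul _).const_add _, fun w =>
    ⟨fun a => (hπ.design_mem hK h0 h1 ω (a, w)).1.le, hπ.sum_design hK t ω w⟩⟩

/-- The rewards are close to the values of the designs. -/
lemma IsRun.exists_sum_value_design_le {δ : ℕ → ℝ} (hrun : IsRun μ PW q φ F pmap δ W A Y fhat)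
    (hq : Measurable q) (hq01 : ∀ x, 0 ≤ q x ∧ q x ≤ 1) (hK : 0 < K)
    (hπ : HasPolicies pmap W A Y fhat)
    (hcur : ∀ t ω, currentPolicy pmap fhat t ω ∈ measurablePolicies K d)
    {t : ℕ} (ht : 1 ≤ t) (hδ : ∀ τ, 1 ≤ τ → 0 < δ τ ∧ δ τ ≤ 1) {x : ℝ} (hx : 0 ≤ x) :
    ∃ E : Set Ω, μ.real E ≤ Real.exp (-x) ∧ ∀ ω, ω ∉ E →
      ∑ τ ∈ Finset.Icc 1 t, (value PW q (design pmap δ fhat τ ω) - Y τ ω) ≤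
        2 * Real.sqrt (t * x) := by
  have ht0 : (0 : ℝ) < t := by exact_mod_cast ht
  have hval : ∀ τ, 1 ≤ τ → ∀ ω, |value PW q (design pmap δ fhat τ ω) - Y τ ω| ≤ 1 := by
    intro τ hτ ω
    have hmem := design_mem_policies hK (hδ τ hτ).1 (hδ τ hτ).2 (hcur (τ - 1) ω) hπ
    have h1 := value_nonneg (PW := PW) hq01 hmem
    have h2 := value_le_one (PW := PW) hq hq01 hmem
    have h3 := hrun.reward_mem_Icc τ ω
    rw [abs_le]
    constructor <;> linarith
  -- For `x ≤ t` the optimal `l = √(x / t)` is at most 1 and `exp y ≤ 1 + y + y²` applies to `y = l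
  -- * (value - reward)`. For `x > t` the sum, at most `t`, is trivially below the bound.
  rcases le_or_gt x t with hxt | hxt
  · set r := Real.sqrt (t * x) with hr
    have hr2 : r ^ 2 = t * x := Real.sq_sqrt (by positivity)
    set l := r / t with hl
    have hl0 : 0 ≤ l := by positivity
    have hl1 : l ≤ 1 := by
      rw [hl, div_le_one ht0]
      exact Real.sqrt_le_iff.2 ⟨ht0.le, by nlinarith⟩
    have hm : ∀ τ, 1 ≤ τ → Measurable[history W A Y τ]
        fun ω => value PW q (design pmap δ fhat τ ω) - Y τ ω := fun τ hτ =>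
      ((IsRun.measurable_value_design hq hπ τ).mono (history_mono (Nat.sub_le _ _)) le_rfl).sub
        (measurable_reward_history hτ)
    have key := measureReal_sum_ge_le (μ := μ) hrun.history_le history_mono (t := t) (b := 1)
      (c := l ^ 2) (l := l) (X := fun τ ω => value PW q (design pmap δ fhat τ ω) - Y τ ω)
      (fun τ hτ => hm τ (Finset.mem_Icc.1 hτ).1) (fun τ hτ => hval τ (Finset.mem_Icc.1 hτ).1) hl0
      ?_ (2 * r)
    · refine ⟨_, key.trans (Real.exp_le_exp.2 (le_of_eq ?_)), fun ω hω => (not_le.1 hω).le⟩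
      have : -l * (2 * r) + t * l ^ 2 = -(r ^ 2 / t) := by rw [hl]; field_simp; ring
      rw [this, hr2]; field_simp
    · intro τ hτ Z hZ hZ0 ⟨M, hM⟩
      have hτ1 := (Finset.mem_Icc.1 hτ).1
      have hZI : Integrable Z μ :=
        integrable_of_measurable_of_abs_le (hZ.mono (hrun.history_le _) le_rfl) hM
      have iY : Integrable (fun ω => Z ω * Y τ ω) μ :=
        hZI.mul_of_abs_le (hrun.measurable_reward τ) (M := 1) fun ω => by
          have := hrun.reward_mem_Icc τ ω
          rw [abs_of_nonneg this.1]; exact this.2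
      have iV : Integrable (fun ω => Z ω * value PW q (design pmap δ fhat τ ω)) μ :=
        hZI.mul_of_abs_le ((IsRun.measurable_value_design hq hπ τ).mono (hrun.history_le _) le_rfl)
          (M := 1) fun ω => by
            have hmem := design_mem_policies hK (hδ τ hτ1).1 (hδ τ hτ1).2 (hcur (τ - 1) ω) hπ
            rw [abs_of_nonneg (value_nonneg hq01 hmem)]
            exact value_le_one hq hq01 hmem
      have e := hrun.integral_past_mul_reward hq hq01 hπ hK hτ1 (hδ τ hτ1).1 (hδ τ hτ1).2 hZ hM
      have hI0 : 0 ≤ ∫ ω, Z ω ∂μ := integral_nonneg hZ0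
      have iS : Integrable (fun ω => Z ω * (1 + l ^ 2) +
          l * (Z ω * value PW q (design pmap δ fhat τ ω))) μ :=
        (hZI.mul_const _).add (iV.const_mul l)
      calc ∫ ω, Z ω * Real.exp (l * (value PW q (design pmap δ fhat τ ω) - Y τ ω)) ∂μ
          ≤ ∫ ω, (Z ω * (1 + l ^ 2) + l * (Z ω * value PW q (design pmap δ fhat τ ω)) -
              l * (Z ω * Y τ ω)) ∂μ := by
            refine integral_mono_of_nonneg
              (Filter.Eventually.of_forall fun ω => mul_nonneg (hZ0 ω) (Real.exp_pos _).le)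
              (iS.sub (iY.const_mul l)) (Filter.Eventually.of_forall fun ω => ?_)
            set y := value PW q (design pmap δ fhat τ ω) - Y τ ω with hy
            have hy1 : |y| ≤ 1 := hval τ hτ1 ω
            have hy2 : y ^ 2 ≤ 1 := (sq_le_one_iff_abs_le_one y).2 hy1
            have h6 : |Real.exp (l * y) - 1 - l * y| ≤ (l * y) ^ 2 := by
              refine Real.abs_exp_sub_one_sub_id_le ?_
              rw [abs_mul, abs_of_nonneg hl0]
              exact mul_le_one₀ hl1 (abs_nonneg _) hy1
            have h7 : Real.exp (l * y) ≤ 1 + l ^ 2 + l * y := by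
              have := (abs_le.1 h6).2
              have := mul_le_mul_of_nonneg_left hy2 (sq_nonneg l)
              nlinarith
            have h8 := mul_le_mul_of_nonneg_left h7 (hZ0 ω)
            refine h8.trans (le_of_eq ?_)
            rw [hy]; ring
        _ = (∫ ω, Z ω ∂μ) * (l ^ 2 + 1) := by
            rw [integral_sub iS (iY.const_mul l), integral_add (hZI.mul_const _) (iV.const_mul l),
              integral_mul_const, integral_const_mul, integral_const_mul, e]
            ring
        _ ≤ (∫ ω, Z ω ∂μ) * Real.exp (l ^ 2) := by
            gcongr
            exact Real.add_one_le_exp _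
        _ = _ := mul_comm _ _
  · refine ⟨∅, by simp [(Real.exp_pos _).le], fun ω _ => ?_⟩
    have h1 : ∑ τ ∈ Finset.Icc 1 t, (value PW q (design pmap δ fhat τ ω) - Y τ ω) ≤
        ∑ _τ ∈ Finset.Icc 1 t, (1 : ℝ) := Finset.sum_le_sum fun τ hτ =>
      (abs_le.1 (hval τ (Finset.mem_Icc.1 hτ).1 ω)).2
    have h2 : (t : ℝ) ≤ Real.sqrt (t * x) := Real.le_sqrt_of_sq_le (by nlinarith)
    simp only [Finset.sum_const, Nat.card_Icc, Nat.add_sub_cancel, nsmul_eq_mul, mul_one] at h1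
    linarith

variable {B : ℝ} {F₀ : Set (Ctx d → ℝ)} {Comp : Set (Regressor K d)}

/-- With high probability, the policy computed at time `t` is nearly optimal. -/
lemma exists_value_sub_le {p c₀ C : ℝ} (hp : 0 < p) (hc₀ : 0 < c₀)
    (hB : 0 < B) (hC : ∀ (t : ℕ) (x : ℝ), 1 ≤ t → 1 ≤ x → ∃ J : ℕ,
      chainBound (B + 1) (1 / rate p t) x t (entropySum p c₀) J + t * chainWidth (B + 1) J ≤
        t * (C * rate p t * Real.sqrt x)) (hC0 : 0 < C) (hK : 0 < K)
    (hq : Measurable q) (hq01 : ∀ x, 0 ≤ q x ∧ q x ≤ 1) (hF₀ : ∀ h ∈ F₀, Measurable h)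
    (hvar : IsDirectVariant F₀ φ F pmap Comp ∨ IsHingeVariant PW q B F₀ φ F pmap Comp)
    (hent : EntropyBound F (refLaw K PW) c₀ p)
    (hrun : IsRun μ PW q φ F pmap (rate p) W A Y fhat) {t : ℕ} (ht : 1 ≤ t) {x : ℝ}
    (hx : 1 ≤ x) :
    ∃ E : Set Ω, μ.real E ≤ 2 * Real.exp (-x) ∧ ∀ ω, ω ∉ E → ∀ π ∈ Comp,
      value PW q π - value PW q (pmap (fhat t ω)) ≤
        (K * C + 1) * rate p t * Real.sqrt x := by
  have := isProbabilityMeasure_refLaw hK PW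
  have hK0 : (0 : ℝ) < K := by exact_mod_cast hK
  have hd := rate_pos (p := p) ht
  have ht0 : (0 : ℝ) < t := by exact_mod_cast ht
  have hsx : 1 ≤ Real.sqrt x := Real.one_le_sqrt.2 hx
  have hπ := hasPolicies_of_variant hF₀ hvar hrun
  rcases le_or_gt x (t * rate p t) with hxt | hxt
  · obtain ⟨ω₀⟩ : Nonempty Ω := nonempty_of_isProbabilityMeasure μ
    -- The slack allowed to the comparator is `rate p t`, the order of the bound being proved. Any
    -- sample point shows that the class is nonempty.
    obtain ⟨fstar, hfs, hosc, hexc⟩ := exists_comparator (B := B) hK hB hq hq01 hF₀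
      ⟨_, hrun.fhat_mem t ht ω₀⟩ hvar hd
    have hφm : Measurable φ := (loss_mono hvar).measurable
    have hfsm := measurable_of_mem_class hF₀ hvar hfs
    obtain ⟨N, l, u, hbr, hN⟩ := exists_isBracketing hent (loss_mono hvar)
      (abs_loss_sub_le hvar) (hφm.comp hfsm)
    have hs := hrun.isWeightedSample hq hq01 hπ hK (t := t) (fun τ hτ =>
      ⟨rate_pos (Finset.mem_Icc.1 hτ).1, rate_le_one hp (Finset.mem_Icc.1 hτ).1,
        rate_antitone hp (Finset.mem_Icc.1 hτ).1 (Finset.mem_Icc.1 hτ).2⟩) ht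
    obtain ⟨J, hJ⟩ := hC t x ht hx
    obtain ⟨E, hE, hgood⟩ := hs.exists_integral_le ht (by positivity) (by linarith : 0 < B + 1)
      (by linarith : 0 ≤ x) (by rw [mul_one_div, div_le_iff₀ hd]; exact hxt)
      (by
        rintro _ ⟨f, hf, rfl⟩
        exact (hφm.comp (measurable_of_mem_class hF₀ hvar hf)).sub (hφm.comp hfsm))
      (by
        rintro _ ⟨f, hf, rfl⟩ y
        exact hosc f hf y) hbr (G := entropySum p c₀) (entropySum_nonneg hp hc₀)
      (fun j => by
        rw [entropySum_succ hp, Real.exp_add]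
        gcongr
        exact hN j) J
    refine ⟨E, hE, fun ω hω π hπc => ?_⟩
    have hmin := hrun.fhat_min t ht ω fstar hfs
    unfold empiricalRisk loss at hmin
    have hmin' := le_of_mul_le_mul_left hmin (by positivity : 0 < (t : ℝ)⁻¹)
    -- Empirical minimality against `fstar` says exactly that the weighted sum of the excess loss is
    -- nonpositive.
    have h1 := hgood ω hω _ ⟨fhat t ω, hrun.fhat_mem t ht ω, rfl⟩ (by
      rw [← sub_nonpos, ← Finset.sum_sub_distrib] at hmin'
      refine le_trans (le_of_eq (Finset.sum_congr rfl fun τ _ => ?_)) hmin'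
      simp only [Function.comp_apply]
      ring)
    have h2 := le_of_mul_le_mul_left (h1.trans hJ) ht0
    refine (hexc _ (hrun.fhat_mem t ht ω) π hπc).trans ?_
    have h3 := mul_le_mul_of_nonneg_left h2 hK0.le
    simp only [Function.comp_apply] at h3
    have h4 : rate p t * 1 ≤ rate p t * Real.sqrt x := by gcongr
    linarith
  · refine ⟨∅, by simp [(Real.exp_pos _).le], fun ω _ π hπc => ?_⟩
    have h1 := value_le_one (PW := PW) hq hq01 (comparator_subset hF₀ hvar hπc)
    have h2 := value_nonneg (PW := PW) hq01 (policy_mem hF₀ hvar (hrun.fhat_mem t ht ω))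
    have h3 := sqrt_mul_rate_ge_one ht hxt.le
    have h4 : 0 ≤ K * C * (rate p t * Real.sqrt x) := by positivity
    linarith

lemma currentPolicy_mem_policies (hF₀ : ∀ h ∈ F₀, Measurable h) (hK : 0 < K) {δ : ℕ → ℝ}
    (hvar : IsDirectVariant F₀ φ F pmap Comp ∨ IsHingeVariant PW q B F₀ φ F pmap Comp)
    (hrun : IsRun μ PW q φ F pmap δ W A Y fhat) (t : ℕ) (ω : Ω) :
    currentPolicy pmap fhat t ω ∈ measurablePolicies K d := by
  refine ⟨?_, (hasPolicies_of_variant hF₀ hvar hrun).currentPolicy_mem hK t ω⟩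
  unfold currentPolicy
  split_ifs with h
  · exact measurable_const
  · exact (policy_mem hF₀ hvar (hrun.fhat_mem t (by omega) ω)).1

/-- The exploration part of the design has nonnegative value and is dropped. -/
lemma le_value_design (hq : Measurable q) (hq01 : ∀ x, 0 ≤ q x ∧ q x ≤ 1) {δ : ℕ → ℝ} {t : ℕ}
    {ω : Ω} (h0 : 0 < δ t)
    (hcur : currentPolicy pmap fhat (t - 1) ω ∈ measurablePolicies K d)
    (hdes : design pmap δ fhat t ω ∈ measurablePolicies K d) :
    (1 - δ t) * value PW q (currentPolicy pmap fhat (t - 1) ω) ≤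
      value PW q (design pmap δ fhat t ω) := by
  rw [value, ← integral_const_mul]
  refine integral_mono ((integrable_value hq hq01 hcur).const_mul _)
    (integrable_value hq hq01 hdes) fun w => ?_
  simp only [Finset.mul_sum]
  refine Finset.sum_le_sum fun a _ => ?_
  have h1 := (hq01 (a, w)).1
  have h2 : 0 ≤ q (a, w) * (δ t * (K : ℝ)⁻¹) := by positivity
  rw [design]
  linarith

/-- The regret of the algorithm at confidence level `x`. -/
theorem exists_regret_le {p c₀ C : ℝ} (hp : 0 < p) (hc₀ : 0 < c₀)
    (hB : 0 < B) (hC : ∀ (t : ℕ) (x : ℝ), 1 ≤ t → 1 ≤ x → ∃ J : ℕ,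
      chainBound (B + 1) (1 / rate p t) x t (entropySum p c₀) J + t * chainWidth (B + 1) J ≤
        t * (C * rate p t * Real.sqrt x)) (hC0 : 0 < C) (hK : 0 < K)
    (hq : Measurable q) (hq01 : ∀ x, 0 ≤ q x ∧ q x ≤ 1) (hF₀ : ∀ h ∈ F₀, Measurable h)
    (hvar : IsDirectVariant F₀ φ F pmap Comp ∨ IsHingeVariant PW q B F₀ φ F pmap Comp)
    (hent : EntropyBound F (refLaw K PW) c₀ p)
    (hrun : IsRun μ PW q φ F pmap (rate p) W A Y fhat) {t : ℕ} (ht : 1 ≤ t) {x : ℝ}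
    (hx : 1 ≤ x) :
    ∃ E : Set Ω, μ.real E ≤ (2 * t + 1) * Real.exp (-x) ∧ ∀ ω, ω ∉ E → ∀ π ∈ Comp,
      ∑ τ ∈ Finset.Icc 1 t, (value PW q π - Y τ ω) ≤
        (4 * (K * C + 1) + 4) * (t : ℝ) ^ (max (2 / 3 : ℝ) (p / (p + 1))) * Real.sqrt x := by
  have hsx : 1 ≤ Real.sqrt x := Real.one_le_sqrt.2 hx
  have hK0 : (0 : ℝ) < K := by exact_mod_cast hK
  have hπ := hasPolicies_of_variant hF₀ hvar hrun
  have hcur := currentPolicy_mem_policies hF₀ hK hvar hrun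
  have hδ : ∀ τ, 1 ≤ τ → 0 < rate p τ ∧ rate p τ ≤ 1 := fun τ hτ =>
    ⟨rate_pos hτ, rate_le_one hp hτ⟩
  obtain ⟨E₀, hE₀, hgood₀⟩ := hrun.exists_sum_value_design_le hq hq01 hK hπ hcur ht hδ
    (by linarith : 0 ≤ x)
  have hτE : ∀ τ : ℕ, ∃ E : Set Ω, μ.real E ≤ 2 * Real.exp (-x) ∧ ∀ ω, ω ∉ E → 1 ≤ τ →
      ∀ π ∈ Comp, value PW q π - value PW q (pmap (fhat τ ω)) ≤
        (K * C + 1) * rate p τ * Real.sqrt x := by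
    intro τ
    by_cases hτ : 1 ≤ τ
    · obtain ⟨E, h1, h2⟩ := exists_value_sub_le hp hc₀ hB hC hC0 hK hq hq01 hF₀ hvar hent hrun
        hτ hx
      exact ⟨E, h1, fun ω hω _ => h2 ω hω⟩
    · exact ⟨∅, by simp [(Real.exp_pos _).le], fun _ _ h => absurd h hτ⟩
  choose E hE hgood using hτE
  refine ⟨E₀ ∪ ⋃ τ ∈ Finset.range t, E τ, ?_, fun ω hω π hπc => ?_⟩
  · refine (measureReal_union_le _ _).trans ?_
    have h1 : μ.real (⋃ τ ∈ Finset.range t, E τ) ≤ ∑ _τ ∈ Finset.range t, 2 * Real.exp (-x) :=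
      (measureReal_biUnion_finset_le _ _).trans (Finset.sum_le_sum fun τ _ => hE τ)
    rw [Finset.sum_const, Finset.card_range, nsmul_eq_mul] at h1
    linarith
  · simp only [Set.mem_union, Set.mem_iUnion, not_or, not_exists] at hω
    set c := (K : ℝ) * C + 1 with hc
    have hc1 : 1 ≤ c := by have : 0 < K * C := by positivity
                           linarith
    have hV1 := value_le_one (PW := PW) hq hq01 (comparator_subset hF₀ hvar hπc)
    have hstep : ∀ τ ∈ Finset.Icc 1 t, value PW q π - value PW q (design pmap (rate p) fhat τ ω) ≤
        (2 * c + 1) * Real.sqrt x * rate p τ := by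
      intro τ hτ
      obtain ⟨hτ1, hτt⟩ := Finset.mem_Icc.1 hτ
      obtain ⟨d0, d1⟩ := hδ τ hτ1
      have hbound : value PW q π - value PW q (currentPolicy pmap fhat (τ - 1) ω) ≤
          2 * c * Real.sqrt x * rate p τ := by
        -- In the first round the policy is uniform and nothing has been learned, but `rate p 1 = 1`
        -- makes the bound trivial. In later rounds the policy comes from time `τ - 1`, which costs
        -- the factor 2 from `rate_le_two_mul_rate_succ`.
        rcases hτ1.eq_or_lt with rfl | hlt
        · have h1 := value_nonneg (PW := PW) hq01 (hcur (1 - 1) ω)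
          have h2 : 1 * 1 ≤ c * Real.sqrt x := mul_le_mul hc1 hsx zero_le_one (by linarith)
          rw [rate_one]
          linarith
        · have hne : τ - 1 ≠ 0 := by omega
          have h1 := hgood (τ - 1) ω (hω.2 (τ - 1) (Finset.mem_range.2 (by omega))) (by omega)
            π hπc
          have h2 := rate_le_two_mul_rate_succ hp (t := τ - 1) (by omega)
          rw [Nat.sub_add_cancel hτ1] at h2
          rw [currentPolicy, if_neg hne]
          have h3 : 0 ≤ c * Real.sqrt x := by positivity
          have h4 := mul_le_mul_of_nonneg_left h2 h3
          linarith
      have hdes := design_mem_policies hK d0 d1 (hcur (τ - 1) ω) hπ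
      have h1 := le_value_design (PW := PW) hq hq01 d0 (hcur (τ - 1) ω) hdes
      have h2 : (1 - rate p τ) * (value PW q π - value PW q (currentPolicy pmap fhat (τ - 1) ω)) ≤
          2 * c * Real.sqrt x * rate p τ := by
        have h3 : 0 ≤ 2 * c * Real.sqrt x * rate p τ := by positivity
        calc _ ≤ (1 - rate p τ) * (2 * c * Real.sqrt x * rate p τ) :=
              mul_le_mul_of_nonneg_left hbound (by linarith)
          _ ≤ _ := mul_le_of_le_one_left h3 (by linarith)
      have h4 : rate p τ * value PW q π ≤ rate p τ * Real.sqrt x := by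
        gcongr
        linarith
      linarith
    have hsum : ∑ τ ∈ Finset.Icc 1 t,
        (value PW q π - value PW q (design pmap (rate p) fhat τ ω)) ≤
          (2 * c + 1) * Real.sqrt x * (2 * (t : ℝ) ^ (max (2 / 3 : ℝ) (p / (p + 1)))) := by
      refine (Finset.sum_le_sum hstep).trans ?_
      rw [← Finset.mul_sum]
      gcongr
      exact sum_rate_le hp t
    have h0 := hgood₀ ω hω.1
    have ht1 : (1 : ℝ) ≤ t := by exact_mod_cast ht
    -- The martingale term is of lower order, since `1/2 ≤ 2/3`.
    have hsqrt : Real.sqrt (t * x) ≤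
        (t : ℝ) ^ (max (2 / 3 : ℝ) (p / (p + 1))) * Real.sqrt x := by
      rw [Real.sqrt_mul (by linarith), Real.sqrt_eq_rpow (t : ℝ)]
      gcongr
      exact le_max_of_le_left (by norm_num)
    have hsplit : ∑ τ ∈ Finset.Icc 1 t, (value PW q π - Y τ ω) =
        ∑ τ ∈ Finset.Icc 1 t, (value PW q π - value PW q (design pmap (rate p) fhat τ ω)) +
          ∑ τ ∈ Finset.Icc 1 t, (value PW q (design pmap (rate p) fhat τ ω) - Y τ ω) := by
      rw [← Finset.sum_add_distrib]
      exact Finset.sum_congr rfl fun τ _ => by ring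
    rw [hsplit]
    linarith

end Regret

end EpsGreedy

/-! ### Choice of the confidence level. -/

theorem mainTheorem3 (K : ℕ) (hK : 2 ≤ K) (p c₀ B : ℝ) (hp : 0 < p) (hp2 : p ≠ 2)
    (hc₀ : 0 < c₀) (hB : 0 < B) :
    ∃ C : ℝ, 0 < C ∧
      ∀ (d : ℕ) (Ω : Type*) [MeasurableSpace Ω] (μ : Measure Ω) [IsProbabilityMeasure μ]
        (PW : Measure (EpsGreedy.Ctx d)) [IsProbabilityMeasure PW]
        (q : Fin K × EpsGreedy.Ctx d → ℝ) (F₀ : Set (EpsGreedy.Ctx d → ℝ))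
        (φ : ℝ → ℝ) (F : Set (EpsGreedy.Regressor K d))
        (pmap : EpsGreedy.Regressor K d → EpsGreedy.Regressor K d)
        (Comp : Set (EpsGreedy.Regressor K d))
        (W : ℕ → Ω → EpsGreedy.Ctx d) (A : ℕ → Ω → Fin K) (Y : ℕ → Ω → ℝ)
        (fhat : ℕ → Ω → EpsGreedy.Regressor K d),
        Measurable q → (∀ x, 0 ≤ q x ∧ q x ≤ 1) →
        (∀ h ∈ F₀, Measurable h) →
        (EpsGreedy.IsDirectVariant F₀ φ F pmap Comp ∨
          EpsGreedy.IsHingeVariant PW q B F₀ φ F pmap Comp) →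
        EpsGreedy.EntropyBound F (EpsGreedy.refLaw K PW) c₀ p →
        EpsGreedy.IsRun μ PW q φ F pmap
          (fun t => (t : ℝ) ^ (-(min (1 / 3 : ℝ) (1 / (p + 1))))) W A Y fhat →
        ∀ (t : ℕ), 1 ≤ t → ∀ ε : ℝ, 0 < ε → ε < 1 →
          ENNReal.ofReal (1 - ε) ≤
            μ {ω | ∀ π ∈ Comp,
              ∑ τ ∈ Finset.Icc 1 t, (EpsGreedy.value PW q π - Y τ ω) ≤
                Real.sqrt (t * Real.log (2 / ε)) +
                  C * (t : ℝ) ^ (max (2 / 3 : ℝ) (p / (p + 1))) *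
                    Real.sqrt (Real.log (2 * t * (t + 1) / ε))} := by
  obtain ⟨C, hC0, hC⟩ := EpsGreedy.exists_chain_rate (c₀ := c₀) hp hp2 hc₀
    (by linarith : 0 < B + 1)
  refine ⟨4 * (K * C + 1) + 4, by positivity, ?_⟩
  intro d Ω _ μ _ PW _ q F₀ φ F pmap Comp W A Y fhat hq hq01 hF₀ hvar hent hrun t ht ε hε hε1
  have hK0 : 0 < K := by omega
  have ht1 : (1 : ℝ) ≤ t := by exact_mod_cast ht
  have hpos : 0 < 2 * (t : ℝ) * (t + 1) / ε := by positivity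
  -- The confidence level is `x = log (2 t (t + 1) / ε)`; it is at least 1 because its argument is
  -- at least `4 > e`.
  have hx : 1 ≤ Real.log (2 * t * (t + 1) / ε) := by
    rw [Real.le_log_iff_exp_le hpos]
    have h1 : (4 : ℝ) ≤ 2 * t * (t + 1) / ε := by
      rw [le_div_iff₀ hε]
      nlinarith
    have := Real.exp_one_lt_d9
    linarith
  obtain ⟨E, hE, hgood⟩ := EpsGreedy.exists_regret_le hp hc₀ hB hC hC0 hK0 hq hq01 hF₀ hvar hent
    hrun ht hx
  -- The union bound costs `(2 t + 1) * ε / (2 t (t + 1))`, and `2 t + 1 ≤ 2 t (t + 1)` for `t ≥ 1`.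
  have hEε : μ.real E ≤ ε := by
    refine hE.trans ?_
    rw [Real.exp_neg, Real.exp_log hpos, inv_div, mul_div_assoc', div_le_iff₀ (by positivity),
      mul_comm ε]
    exact mul_le_mul_of_nonneg_right (by nlinarith) hε.le
  -- The martingale deviation is already absorbed in the second term, so the nonnegative term `√(t
  -- log (2 / ε))` is simply added.
  have hsub : Eᶜ ⊆ {ω | ∀ π ∈ Comp,
      ∑ τ ∈ Finset.Icc 1 t, (EpsGreedy.value PW q π - Y τ ω) ≤
        Real.sqrt (t * Real.log (2 / ε)) +
          (4 * (K * C + 1) + 4) * (t : ℝ) ^ (max (2 / 3 : ℝ) (p / (p + 1))) *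
            Real.sqrt (Real.log (2 * t * (t + 1) / ε))} := fun ω hω π hπ =>
    (hgood ω hω π hπ).trans (le_add_of_nonneg_left (Real.sqrt_nonneg _))
  refine le_trans ?_ (measure_mono hsub)
  -- Subadditivity is enough, so neither `E` nor the event of the statement has to be measurable.
  have h1 : 1 ≤ μ.real E + μ.real Eᶜ := by
    rw [← probReal_univ (μ := μ), ← Set.union_compl_self E]
    exact measureReal_union_le _ _
  refine ENNReal.ofReal_le_of_le_toReal ?_
  change 1 - ε ≤ μ.real Eᶜ
  linarith
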